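/- **Setting.** Work over $\mathbb C$. Let $U=U(\mathfrak{osp}(1|2))$ be the (ungraded) associative algebra generated by $e,f,h,p,q$ with relations $he-eh=2e$, $hf-fh=-2f$, $ef-fe=h$, $hp-ph=p$, $hq-qh=-q$, $p^2=e$, $q^2=-f$, $pq+qp=h$. Put $\Sigma=pq-qp+\tfrac12$, let $\langle\Sigma\rangle$ be the two-sided ideal generated by $\Sigma$, and $H=\mathbb C[h]$. A $U$-module $M$ is $H$-torsion free of rank $1$ if it is torsion free over $H$ and $\dim_{\mathbb C(h)}\mathbb C(h)\otimes_H M=1$. Let $\mathbf A_1=\langle a,b: ab-ba=1\rangle$ and let $\Theta:U\to\mathbf A_1$ be the algebra homomorphism with $\Theta(p)=\tfrac1{\sqrt2}a$, $\Theta(q)=-\tfrac1{\sqrt2}b$ (so $\Theta(h)=-\tfrac12(ab+ba)$, $\Theta(e)=\tfrac12a^2$, $\Theta(f)=-\tfrac12b^2$); $\Theta^*$ denotes pullback along $\Theta$. Let $\mathtt h$ be a variable (not to be confused with $h\in U$), let $\sigma$ be the automorphism of $\mathbb C(\mathtt h)$ over $\mathbb C$ with $\sigma(\mathtt h)=\mathtt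 h-2$, and let $\mathbb C_0=\{z\in\mathbb C: 0\le \operatorname{Re} z<2\}$. For $c\in\mathbb C^\times$ and a finitely supported function $\mathtt m:\mathbb C_0\to\mathbb Z$ put $$u=u_{c,\mathtt m}=c\prod_{t\in\mathbb C_0}(\mathtt h-t)^{\mathtt m(t)}\in\mathbb C(\mathtt h)^\times .$$ Let $N_u$ be the space $\mathbb C(\mathtt h)$ with the $\mathbf A_1$-action $a\cdot r=\sigma(r)\,u$ and $b\cdot r=-\frac{\mathtt h+2}{2}\cdot\frac{\sigma^{-1}(r)}{\sigma^{-1}(u)}$; that is, $a$ acts as $x$ and $b$ as $-\tfrac12x^{-1}\mathtt h$, where $x\cdot r=\sigma(r)u$. Let $F_u$ be the socle of the $\mathbf A_1$-module $N_u$ (the sum of its simple submodules), and let $D_u\subset N_u$ be the $\mathbb C$-linear span of * $\mathbb C[\mathtt h]$; * $(\mathtt h-s-2i)^{-k}$ for $s\in\mathbb C_0$ with $\mathtt m(s)<0$, $i\ge 0$, $1\le k\le-\mathtt m(s)$; * $(\mathtt h-s+2i)^{-k}$ for $s\in\mathbb C_0\setminus\{0\}$ with $\mathtt m(s)>0$,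 $i\ge1$, $1\le k\le\mathtt m(s)$; * $(\mathtt h+2i)^{-k}$ for $i\ge1$, $1\le k\le\mathtt m(0)-1$, if $\mathtt m(0)>0$. **Theorem.** 1. $\Theta$ induces an isomorphism $U/\langle\Sigma\rangle\cong\mathbf A_1$. 2. On every simple (ungraded) $U$-module that is $H$-torsion free of rank $1$, the element $\Sigma$ acts by zero, and hence the action factors through $U/\langle\Sigma\rangle$. 3. For all $(c,\mathtt m)$ and $u=u_{c,\mathtt m}$, the $\mathbf A_1$-module $F_u$ is simple and $F_u=D_u$. 4. The modules $\Theta^*(F_u)=\Theta^*(D_u)$, for $u=u_{c,\mathtt m}$, form a complete and irredundant list of representatives of the isomorphism classes of simple $U$-modules that are $H$-torsion free of rank $1$: each of them is simple and $H$-torsion free of rank $1$, every such module is isomorphic to one of them, and $\Theta^*(F_{u_{c,\mathtt m}})\cong\Theta^*(F_{u_{c',\mathtt m'}})$ implies $(c,\mathtt m)=(c',\mathtt m')$. -/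

import Mathlib

open scoped Polynomial TensorProduct

noncomputable section

namespace OspRankOne

/-! ### The enveloping algebra of the Lie superalgebra osp(1|2) -/

/-- The even generators `e, f, h` and the odd generators `p, q` of `osp(1|2)`. -/
inductive Gen : Type
  | e | f | h | p | q

open FreeAlgebra in
/-- The defining relations of `osp(1|2)`, written in the enveloping superalgebra: a bracket of two
elements, at least one of them even, is a commutator, and a bracket of two odd elements is an
anticommutator, so that `[p, p] = 2 e` and `[q, q] = -2 f` read `p ^ 2 = e` and `q ^ 2 = -f`. -/
inductive URel : FreeAlgebra ℂ Gen → FreeAlgebra ℂ Gen → Prop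
  | he : URel (ι ℂ Gen.h * ι ℂ Gen.e - ι ℂ Gen.e * ι ℂ Gen.h) (2 * ι ℂ Gen.e)
  | hf : URel (ι ℂ Gen.h * ι ℂ Gen.f - ι ℂ Gen.f * ι ℂ Gen.h) (-(2 * ι ℂ Gen.f))
  | ef : URel (ι ℂ Gen.e * ι ℂ Gen.f - ι ℂ Gen.f * ι ℂ Gen.e) (ι ℂ Gen.h)
  | hp : URel (ι ℂ Gen.h * ι ℂ Gen.p - ι ℂ Gen.p * ι ℂ Gen.h) (ι ℂ Gen.p)
  | hq : URel (ι ℂ Gen.h * ι ℂ Gen.q - ι ℂ Gen.q * ι ℂ Gen.h) (-ι ℂ Gen.q)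
  | pp : URel (ι ℂ Gen.p * ι ℂ Gen.p) (ι ℂ Gen.e)
  | qq : URel (ι ℂ Gen.q * ι ℂ Gen.q) (-ι ℂ Gen.f)
  | pq : URel (ι ℂ Gen.p * ι ℂ Gen.q + ι ℂ Gen.q * ι ℂ Gen.p) (ι ℂ Gen.h)

/-- `U(osp(1|2))`, as an ungraded associative algebra over the complex numbers. -/
def U : Type := RingQuot URel

instance : Ring U := inferInstanceAs (Ring (RingQuot URel))
instance : Algebra ℂ U := inferInstanceAs (Algebra ℂ (RingQuot URel))

namespace U

/-- The projection from the free algebra on the generators. -/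
def mk : FreeAlgebra ℂ Gen →ₐ[ℂ] U := RingQuot.mkAlgHom ℂ URel

theorem mk_rel {x y : FreeAlgebra ℂ Gen} (hxy : URel x y) : mk x = mk y :=
  RingQuot.mkAlgHom_rel ℂ hxy

/-- The image of a generator in `U(osp(1|2))`. -/
def gen (x : Gen) : U := mk (FreeAlgebra.ι ℂ x)

def e : U := gen Gen.e
def f : U := gen Gen.f
def h : U := gen Gen.h
def p : U := gen Gen.p
def q : U := gen Gen.q

/-- The SCasimir element `Σ = p q - q p + 1/2`. -/
def scasimir : U := p * q - q * p + algebraMap ℂ U (1 / 2)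

theorem h_mul_p : h * p - p * h = p := by
  simpa [h, p, gen] using mk_rel URel.hp

theorem h_mul_q : h * q - q * h = -q := by
  simpa [h, q, gen] using mk_rel URel.hq

theorem p_mul_p : p * p = e := by
  simpa [e, p, gen] using mk_rel URel.pp

theorem q_mul_q : q * q = -f := by
  simpa [f, q, gen] using mk_rel URel.qq

theorem p_mul_q : p * q + q * p = h := by
  simpa [h, p, q, gen] using mk_rel URel.pq

/-! The brackets of `osp(1|2)` that are not listed in `URel` follow from those that are. -/

theorem e_mul_p : e * p - p * e = 0 := by
  rw [← p_mul_p]; noncomm_ring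

theorem f_mul_q : f * q - q * f = 0 := by
  have hf : f = -(q * q) := by rw [q_mul_q, neg_neg]
  rw [hf]; noncomm_ring

theorem e_mul_q : e * q - q * e = -p := by
  have key : p * p * q - q * (p * p) = -(h * p - p * h) := by
    rw [← p_mul_q]; noncomm_ring
  rw [← p_mul_p, key, h_mul_p]

theorem f_mul_p : f * p - p * f = -q := by
  have hf : f = -(q * q) := by rw [q_mul_q, neg_neg]
  have key : -(q * q) * p - p * -(q * q) = h * q - q * h := by
    rw [← p_mul_q]; noncomm_ring
  rw [hf, key, h_mul_q]

end U

/-- The quotient of `U(osp(1|2))` by the two-sided ideal generated by the SCasimir element. -/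
abbrev UBar : Type := (TwoSidedIdeal.span {U.scasimir}).ringCon.Quotient

/-- The canonical projection from `U(osp(1|2))` onto that quotient. -/
def toUBar : U →ₐ[ℂ] UBar := RingCon.mkₐ ℂ (TwoSidedIdeal.span {U.scasimir}).ringCon

/-! ### The first Weyl algebra and the homomorphism from `U(osp(1|2))` -/

/-- The generators of the first Weyl algebra. -/
inductive WGen : Type
  | a | b

open FreeAlgebra in
/-- The relation `a b - b a = 1`. -/
inductive WRel : FreeAlgebra ℂ WGen → FreeAlgebra ℂ WGen → Prop
  | ab : WRel (ι ℂ WGen.a * ι ℂ WGen.b - ι ℂ WGen.b * ι ℂ WGen.a) 1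

/-- The first Weyl algebra `⟨a, b : a b - b a = 1⟩` over the complex numbers. -/
def Weyl : Type := RingQuot WRel

instance : Ring Weyl := inferInstanceAs (Ring (RingQuot WRel))
instance : Algebra ℂ Weyl := inferInstanceAs (Algebra ℂ (RingQuot WRel))

namespace Weyl

/-- The projection from the free algebra on the generators. -/
def mk : FreeAlgebra ℂ WGen →ₐ[ℂ] Weyl := RingQuot.mkAlgHom ℂ WRel

theorem mk_rel {x y : FreeAlgebra ℂ WGen} (hxy : WRel x y) : mk x = mk y :=
  RingQuot.mkAlgHom_rel ℂ hxy

def a : Weyl := mk (FreeAlgebra.ι ℂ WGen.a)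
def b : Weyl := mk (FreeAlgebra.ι ℂ WGen.b)

theorem a_mul_b : a * b = b * a + 1 := by
  have := mk_rel WRel.ab
  rw [map_sub, map_mul, map_mul, map_one] at this
  exact sub_eq_iff_eq_add'.mp this

/-- The algebra homomorphism out of the Weyl algebra given by two elements `x, y` with
`x y - y x = 1`. -/
def lift {A : Type*} [Ring A] [Algebra ℂ A] (x y : A) (hxy : x * y - y * x = 1) : Weyl →ₐ[ℂ] A :=
  RingQuot.liftAlgHom ℂ
    ⟨FreeAlgebra.lift ℂ (fun g : WGen => WGen.casesOn g x y), by
      rintro _ _ ⟨⟩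
      simpa using hxy⟩

end Weyl

/-- The complex number `1 / √2`. -/
def invSqrtTwo : ℂ := ((1 / Real.sqrt 2 : ℝ) : ℂ)

theorem invSqrtTwo_mul_self : invSqrtTwo * invSqrtTwo = 1 / 2 := by
  unfold invSqrtTwo
  rw [← Complex.ofReal_mul]
  have : (1 / Real.sqrt 2) * (1 / Real.sqrt 2) = 1 / 2 := by
    rw [div_mul_div_comm, Real.mul_self_sqrt (by norm_num), one_mul]
  rw [this]; norm_num

open Weyl in
/-- The values of the homomorphism `Θ` on the generators. -/
def thetaGen : Gen → Weyl
  | Gen.e => (1 / 2 : ℂ) • (a * a)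
  | Gen.f => -((1 / 2 : ℂ) • (b * b))
  | Gen.h => -((1 / 2 : ℂ) • (a * b + b * a))
  | Gen.p => invSqrtTwo • a
  | Gen.q => -(invSqrtTwo • b)

theorem thetaGen_rel ⦃x y : FreeAlgebra ℂ Gen⦄ (hxy : URel x y) :
    FreeAlgebra.lift ℂ thetaGen x = FreeAlgebra.lift ℂ thetaGen y := by
  have key := Weyl.a_mul_b
  have key' : ∀ t : Weyl, Weyl.a * (Weyl.b * t) = Weyl.b * (Weyl.a * t) + t := fun t => by
    rw [← mul_assoc, key, add_mul, one_mul, mul_assoc]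
  have hs := invSqrtTwo_mul_self
  cases hxy <;>
    simp only [map_add, map_sub, map_mul, map_neg, FreeAlgebra.lift_ι_apply, thetaGen,
      mul_add, add_mul, mul_neg, neg_mul, smul_mul_assoc, mul_smul_comm, smul_smul, smul_add,
      smul_neg, hs, key, key', mul_assoc, mul_one, one_mul, two_mul] <;>
    module

/-- The algebra homomorphism `Θ : U(osp(1|2)) → A₁` with `p ↦ a / √2` and `q ↦ -b / √2`. -/
def Theta : U →ₐ[ℂ] Weyl :=
  RingQuot.liftAlgHom ℂ ⟨FreeAlgebra.lift ℂ thetaGen, thetaGen_rel⟩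

/-- The pullback `Θ* M` of a module `M` over the Weyl algebra. -/
def Pullback (M : Type*) : Type _ := M

instance (M : Type*) [AddCommGroup M] : AddCommGroup (Pullback M) :=
  inferInstanceAs (AddCommGroup M)

instance (M : Type*) [AddCommGroup M] [Module Weyl M] : Module U (Pullback M) :=
  Module.compHom M (Theta : U →+* Weyl)

/-! ### Torsion free modules of rank one over `H = ℂ[h]` -/

/-- A `U(osp(1|2))`-module regarded as a module over `H = ℂ[h]`. -/
def ResH (M : Type*) : Type _ := M

instance (M : Type*) [AddCommGroup M] : AddCommGroup (ResH M) :=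
  inferInstanceAs (AddCommGroup M)

instance (M : Type*) [AddCommGroup M] [Module U M] : Module ℂ[X] (ResH M) :=
  Module.compHom M ((Polynomial.aeval U.h : ℂ[X] →ₐ[ℂ] U) : ℂ[X] →+* U)

/-- The `U(osp(1|2))`-module `M` is torsion free over `H = ℂ[h]`, and `ℂ(h) ⊗_H M` has
dimension `1` over `ℂ(h)`. -/
def IsTorsionFreeOfRankOne (M : Type*) [AddCommGroup M] [Module U M] : Prop :=
  Module.IsTorsionFree ℂ[X] (ResH M) ∧
    Module.rank (RatFunc ℂ) (RatFunc ℂ ⊗[ℂ[X]] ResH M) = 1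

/-! ### The modules `N_u`, `F_u` and `D_u` over the Weyl algebra -/

/-- The automorphism `σ` of `ℂ(h)` that is the identity on `ℂ` and sends `h` to `h - 2`. -/
def sigma : RatFunc ℂ ≃ₐ[ℂ] RatFunc ℂ :=
  IsFractionRing.algEquivOfAlgEquiv (Polynomial.algEquivAevalXAddC (-2 : ℂ))

theorem sigma_X : sigma RatFunc.X = RatFunc.X - 2 := by
  rw [← RatFunc.algebraMap_X, sigma, IsFractionRing.algEquivOfAlgEquiv_algebraMap]
  have h2 : (RatFunc.C (2 : ℂ)) = 2 := map_ofNat _ 2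
  simp [Polynomial.algEquivAevalXAddC, sub_eq_add_neg, h2]

/-- The action `r ↦ σ(r) u` of `x` on the one-dimensional module `N_u = ℂ(h)` over the skew
Laurent polynomial algebra `ℂ(h)[x, x⁻¹, σ]`. -/
def xAct (u : (RatFunc ℂ)ˣ) : RatFunc ℂ ≃ₗ[ℂ] RatFunc ℂ where
  toFun r := sigma r * u
  invFun r := sigma.symm (r * (u⁻¹ : (RatFunc ℂ)ˣ))
  map_add' r s := by rw [map_add, add_mul]
  map_smul' c r := by
    rw [RingHom.id_apply, Algebra.smul_def, Algebra.smul_def, map_mul, AlgEquiv.commutes, mul_assoc]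
  left_inv r := by simp
  right_inv r := by simp

theorem weyl_rel (u : (RatFunc ℂ)ˣ) :
    (xAct u : Module.End ℂ (RatFunc ℂ)) *
        (-((1 / 2 : ℂ) • ((xAct u).symm.toLinearMap ∘ₗ LinearMap.mulLeft ℂ RatFunc.X))) -
      (-((1 / 2 : ℂ) • ((xAct u).symm.toLinearMap ∘ₗ LinearMap.mulLeft ℂ RatFunc.X))) *
        (xAct u : Module.End ℂ (RatFunc ℂ)) = 1 := by
  have hx : ∀ r, (xAct u).symm (RatFunc.X * xAct u r) = (RatFunc.X + 2) * r := fun r => by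
    rw [LinearEquiv.symm_apply_eq]
    change RatFunc.X * (sigma r * (u : RatFunc ℂ)) = sigma ((RatFunc.X + 2) * r) * (u : RatFunc ℂ)
    rw [map_mul, map_add, sigma_X, map_ofNat]
    ring
  ext r
  simp only [LinearMap.sub_apply, Module.End.mul_apply, LinearMap.neg_apply, LinearMap.smul_apply,
    LinearMap.comp_apply, LinearMap.mulLeft_apply, LinearEquiv.coe_coe, map_neg, map_smul,
    LinearEquiv.apply_symm_apply, Module.End.one_apply, hx, add_mul, smul_add]
  have h2 : (2 : RatFunc ℂ) * r = (2 : ℂ) • r := by rw [two_mul, two_smul]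
  rw [h2]
  module

/-- The action of the Weyl algebra on `N_u`, along the embedding `a ↦ x`,
`b ↦ -(1/2) x⁻¹ h = -((h + 2)/2) x⁻¹` of the Weyl algebra into `ℂ(h)[x, x⁻¹, σ]`. -/
def weylAct (u : (RatFunc ℂ)ˣ) : Weyl →ₐ[ℂ] Module.End ℂ (RatFunc ℂ) :=
  Weyl.lift (xAct u : Module.End ℂ (RatFunc ℂ))
    (-((1 / 2 : ℂ) • ((xAct u).symm.toLinearMap ∘ₗ LinearMap.mulLeft ℂ RatFunc.X)))
    (weyl_rel u)

/-- The module `N_u`: the space `ℂ(h)` with the action of the Weyl algebra determined by `u`. -/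
def N (_u : (RatFunc ℂ)ˣ) : Type := RatFunc ℂ

instance (u : (RatFunc ℂ)ˣ) : AddCommGroup (N u) := inferInstanceAs (AddCommGroup (RatFunc ℂ))
instance (u : (RatFunc ℂ)ˣ) : Module ℂ (N u) := inferInstanceAs (Module ℂ (RatFunc ℂ))
instance (u : (RatFunc ℂ)ˣ) : Module Weyl (N u) :=
  Module.compHom (RatFunc ℂ) (weylAct u : Weyl →+* Module.End ℂ (RatFunc ℂ))
instance (u : (RatFunc ℂ)ˣ) : IsScalarTower ℂ Weyl (N u) where
  smul_assoc c w r := by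
    change weylAct u (c • w) r = c • weylAct u w r
    rw [map_smul]; rfl

/-- The socle `F_u` of the module `N_u` over the Weyl algebra: the sum of its simple submodules. -/
def F (u : (RatFunc ℂ)ˣ) : Submodule Weyl (N u) :=
  sSup {S : Submodule Weyl (N u) | IsSimpleModule Weyl S}

/-- The strip of complex numbers whose real part lies in `[0, 2)`. -/
def Strip : Set ℂ := {z : ℂ | 0 ≤ z.re ∧ z.re < 2}

theorem X_sub_C_ne_zero (t : ℂ) : (RatFunc.X - RatFunc.C t : RatFunc ℂ) ≠ 0 := by
  rw [← RatFunc.algebraMap_X, ← RatFunc.algebraMap_C, ← map_sub]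
  exact RatFunc.algebraMap_ne_zero (Polynomial.X_sub_C_ne_zero t)

/-- The rational function `c ∏ (h - t) ^ m(t)`, the product over `t` in the strip, for a non-zero
complex number `c` and a finitely supported function `m` from the strip to the integers. -/
def uOf (c : ℂˣ) (m : Strip →₀ ℤ) : (RatFunc ℂ)ˣ :=
  Units.map (algebraMap ℂ (RatFunc ℂ) : ℂ →* RatFunc ℂ) c *
    m.prod (fun t k => (Units.mk0 (RatFunc.X - RatFunc.C (t : ℂ)) (X_sub_C_ne_zero (t : ℂ))) ^ k)

/-- The elements that span `D_u`, for `u = c ∏ (h - t) ^ m(t)`. -/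
def dGenerators (m : Strip →₀ ℤ) : Set (RatFunc ℂ) :=
  {r | ∃ P : ℂ[X], r = algebraMap ℂ[X] (RatFunc ℂ) P} ∪
  {r | ∃ s : Strip, m s < 0 ∧ ∃ i k : ℕ, 1 ≤ k ∧ (k : ℤ) ≤ -m s ∧
    r = 1 / (RatFunc.X - RatFunc.C ((s : ℂ) + 2 * (i : ℂ))) ^ k} ∪
  {r | ∃ s : Strip, (s : ℂ) ≠ 0 ∧ 0 < m s ∧ ∃ i k : ℕ, 0 < i ∧ 1 ≤ k ∧ (k : ℤ) ≤ m s ∧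
    r = 1 / (RatFunc.X - RatFunc.C ((s : ℂ) - 2 * (i : ℂ))) ^ k} ∪
  {r | ∃ s : Strip, (s : ℂ) = 0 ∧ 0 < m s ∧ ∃ i k : ℕ, 0 < i ∧ 1 ≤ k ∧ (k : ℤ) ≤ m s - 1 ∧
    r = 1 / (RatFunc.X + RatFunc.C (2 * (i : ℂ))) ^ k}

/-- The subspace `D_u` of `N_u`, for `u = c ∏ (h - t) ^ m(t)`. -/
def D (c : ℂˣ) (m : Strip →₀ ℤ) : Submodule ℂ (N (uOf c m)) :=
  Submodule.span ℂ (dGenerators m : Set (RatFunc ℂ))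

end OspRankOne

end

open OspRankOne

noncomputable section

namespace OspRankOne

-- `Θ` kills `Σ`, and the relation `Σ = 0` reads `pq - qp = -1/2`. So `√2 p` and `-√2 q` satisfy the
-- Weyl relation, which inverts the map induced by `Θ`.
--
-- A torsion free module of rank one embeds in `ℂ(h)` so that `2h - 1` becomes multiplication by the
-- variable. Commutation with `h` then makes `p` act as `r ↦ σ(r) w` and `Σ` as multiplication by
-- some `g` (`exists_multiplier`). Since `Σ` anticommutes with `p` and `w ≠ 0`, this forces `σ(g) =
-- -g`. But `σ` preserves leading coefficients, hence `g = 0`. With `Σ = 0` the action of `q` is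
-- determined by those of `h` and `p`, so the module sits inside `N_u` with `u = √2 w`.
--
-- Rescaling the embedding by `g` multiplies `u` by `g / σ(g)`. Modulo such factors, zeros and poles
-- can be moved by multiples of 2 into the strip, and the result `u_{c,m}` is unique
-- (`exists_normalForm`, `normalForm_unique`).
--
-- By partial fractions `D_u` contains every rational function whose pole orders respect a bound
-- `poleBound`, and this gives stability under `a` and `b`. Conversely every non-zero submodule of
-- `N_u` contains all polynomials, and then the required poles, found in `aⁿ·1` and `bⁿ·1`
-- (`DWeyl_le`). So `D_u` is the unique minimal submodule, hence the socle. A simple module embedded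
-- in `N_u` must coincide with it, and an isomorphism between two such modules is multiplication by
-- some `g`, to which uniqueness of normal forms applies.

local notation "toRat" => algebraMap ℂ[X] (RatFunc ℂ)

/-! ### Orders of vanishing of rational functions -/

/-- The order of vanishing of a rational function at a complex number (junk value `0` at `0`). -/
def ordAt (l : ℂ) (r : RatFunc ℂ) : ℤ := r.num.rootMultiplicity l - r.denom.rootMultiplicity l

theorem toRat_ne_zero {A : ℂ[X]} (hA : A ≠ 0) : toRat A ≠ 0 := RatFunc.algebraMap_ne_zero hA

theorem ordAt_div (l : ℂ) {A B : ℂ[X]} (hA : A ≠ 0) (hB : B ≠ 0) :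
    ordAt l (toRat A / toRat B) = A.rootMultiplicity l - B.rootMultiplicity l := by
  set r := toRat A / toRat B with hr
  have hr0 : r ≠ 0 := div_ne_zero (toRat_ne_zero hA) (toRat_ne_zero hB)
  have key : r.num * B = A * r.denom := (RatFunc.num_mul_eq_mul_denom_iff hB).2 hr
  have h1 := congrArg (Polynomial.rootMultiplicity l) key
  rw [Polynomial.rootMultiplicity_mul (mul_ne_zero (RatFunc.num_ne_zero hr0) hB),
    Polynomial.rootMultiplicity_mul (mul_ne_zero hA r.denom_ne_zero)] at h1
  unfold ordAt
  omega

theorem ordAt_toRat (l : ℂ) (A : ℂ[X]) : ordAt l (toRat A) = A.rootMultiplicity l := by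
  simp [ordAt, RatFunc.num_algebraMap, RatFunc.denom_algebraMap]

theorem ordAt_one (l : ℂ) : ordAt l 1 = 0 := by
  simp [ordAt]

theorem exists_div (r : RatFunc ℂ) : ∃ A B : ℂ[X], B ≠ 0 ∧ r = toRat A / toRat B :=
  ⟨r.num, r.denom, r.denom_ne_zero, r.num_div_denom.symm⟩

theorem exists_div_of_ne_zero {r : RatFunc ℂ} (hr : r ≠ 0) :
    ∃ A B : ℂ[X], A ≠ 0 ∧ B ≠ 0 ∧ r = toRat A / toRat B :=
  ⟨r.num, r.denom, RatFunc.num_ne_zero hr, r.denom_ne_zero, r.num_div_denom.symm⟩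

theorem ordAt_mul (l : ℂ) {r s : RatFunc ℂ} (hr : r ≠ 0) (hs : s ≠ 0) :
    ordAt l (r * s) = ordAt l r + ordAt l s := by
  obtain ⟨A, B, hA, hB, rfl⟩ := exists_div_of_ne_zero hr
  obtain ⟨A', B', hA', hB', rfl⟩ := exists_div_of_ne_zero hs
  rw [div_mul_div_comm, ← map_mul, ← map_mul, ordAt_div l (mul_ne_zero hA hA') (mul_ne_zero hB hB'),
    ordAt_div l hA hB, ordAt_div l hA' hB', Polynomial.rootMultiplicity_mul (mul_ne_zero hA hA'),
    Polynomial.rootMultiplicity_mul (mul_ne_zero hB hB')]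
  push_cast
  ring

theorem ordAt_inv (l : ℂ) {r : RatFunc ℂ} (hr : r ≠ 0) : ordAt l r⁻¹ = -ordAt l r := by
  have := ordAt_mul l hr (inv_ne_zero hr)
  rw [mul_inv_cancel₀ hr, ordAt_one] at this
  omega

theorem sigma_toRat (A : ℂ[X]) :
    sigma (toRat A) = toRat (A.comp (Polynomial.X - Polynomial.C 2)) := by
  rw [sigma, IsFractionRing.algEquivOfAlgEquiv_algebraMap]
  simp [Polynomial.algEquivAevalXAddC, Polynomial.comp, Polynomial.aeval_def, sub_eq_add_neg,
    Polynomial.algebraMap_eq]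

theorem comp_X_sub_C_ne_zero {A : ℂ[X]} (hA : A ≠ 0) :
    A.comp (Polynomial.X - Polynomial.C 2) ≠ 0 := by
  intro h
  apply hA
  apply RatFunc.algebraMap_injective ℂ
  rw [map_zero, ← map_eq_zero_iff sigma sigma.injective, sigma_toRat, h, map_zero]

theorem rootMultiplicity_comp_X_sub_two (A : ℂ[X]) (l : ℂ) :
    (A.comp (Polynomial.X - Polynomial.C 2)).rootMultiplicity l = A.rootMultiplicity (l - 2) := by
  rw [Polynomial.rootMultiplicity_eq_rootMultiplicity,
    Polynomial.rootMultiplicity_eq_rootMultiplicity (p := A), Polynomial.comp_assoc]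
  congr 2
  simp
  ring

theorem ordAt_sigma (l : ℂ) (r : RatFunc ℂ) : ordAt l (sigma r) = ordAt (l - 2) r := by
  rcases eq_or_ne r 0 with rfl | hr
  · rw [map_zero, ← map_zero toRat, ordAt_toRat, ordAt_toRat, Polynomial.rootMultiplicity_zero,
      Polynomial.rootMultiplicity_zero]
  obtain ⟨A, B, hA, hB, rfl⟩ := exists_div_of_ne_zero hr
  rw [map_div₀, sigma_toRat, sigma_toRat, ordAt_div l (comp_X_sub_C_ne_zero hA)
    (comp_X_sub_C_ne_zero hB), ordAt_div _ hA hB, rootMultiplicity_comp_X_sub_two,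
    rootMultiplicity_comp_X_sub_two]

theorem ordAt_sigma_symm (l : ℂ) (r : RatFunc ℂ) : ordAt l (sigma.symm r) = ordAt (l + 2) r := by
  have := ordAt_sigma (l + 2) (sigma.symm r)
  rw [AlgEquiv.apply_symm_apply] at this
  rw [this, add_sub_cancel_right]

theorem ordAt_C (l c : ℂ) : ordAt l (RatFunc.C c) = 0 := by
  rw [← RatFunc.algebraMap_C, ordAt_toRat, Polynomial.rootMultiplicity_C]; rfl

theorem ordAt_X_sub_C (l t : ℂ) : ordAt l (RatFunc.X - RatFunc.C t) = if l = t then 1 else 0 := by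
  rw [← RatFunc.algebraMap_X, ← RatFunc.algebraMap_C, ← map_sub, ordAt_toRat,
    Polynomial.rootMultiplicity_X_sub_C]
  split_ifs <;> rfl

theorem ordAt_X (l : ℂ) : ordAt l RatFunc.X = if l = 0 then 1 else 0 := by
  simpa using ordAt_X_sub_C l 0

theorem ordAt_pow (l : ℂ) {r : RatFunc ℂ} (hr : r ≠ 0) (k : ℕ) :
    ordAt l (r ^ k) = k * ordAt l r := by
  induction k with
  | zero => simp [ordAt_one]
  | succ k ih => rw [pow_succ, ordAt_mul l (pow_ne_zero k hr) hr, ih]; push_cast; ring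

theorem ordAt_zpow (l : ℂ) {r : RatFunc ℂ} (hr : r ≠ 0) (k : ℤ) :
    ordAt l (r ^ k) = k * ordAt l r := by
  obtain ⟨n, rfl | rfl⟩ := k.eq_nat_or_neg
  · rw [zpow_natCast, ordAt_pow l hr]
  · rw [zpow_neg, zpow_natCast, ordAt_inv l (pow_ne_zero n hr), ordAt_pow l hr]; ring

theorem finite_ordAt_ne_zero {r : RatFunc ℂ} (hr : r ≠ 0) : {l | ordAt l r ≠ 0}.Finite := by
  refine ((r.num.roots.toFinset ∪ r.denom.roots.toFinset).finite_toSet).subset fun l hl => ?_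
  by_contra hmem
  apply hl
  simp only [Finset.coe_union, Set.mem_union, Finset.mem_coe, Multiset.mem_toFinset, not_or,
    Polynomial.mem_roots (RatFunc.num_ne_zero hr), Polynomial.mem_roots r.denom_ne_zero] at hmem
  rw [ordAt, Polynomial.rootMultiplicity_eq_zero hmem.1, Polynomial.rootMultiplicity_eq_zero hmem.2]
  rfl

/-- An infinite arithmetic progression cannot stay inside the finite set of zeros and poles. This
allows a zero or pole to be avoided by iterating a shift. -/
theorem exists_ordAt_add_eq_zero {r : RatFunc ℂ} (hr : r ≠ 0) (l : ℂ) {z : ℂ} (hz : z ≠ 0) :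
    ∃ n : ℕ, ordAt (l + n * z) r = 0 := by
  by_contra! h
  have hinj : Function.Injective fun n : ℕ => l + n * z := fun a b hab => by
    simpa [hz] using hab
  exact Set.infinite_of_injective_forall_mem hinj h (finite_ordAt_ne_zero hr)

/-- An eigenvector of `σ` has eigenvalue `1`, by comparison of leading coefficients. -/
theorem eq_one_of_sigma_eq {g : RatFunc ℂ} (hg : g ≠ 0) {c : ℂ} (h : sigma g = RatFunc.C c * g) :
    c = 1 := by
  obtain ⟨A, B, hA, hB, rfl⟩ := exists_div_of_ne_zero hg
  have hB' := comp_X_sub_C_ne_zero hB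
  rw [map_div₀, sigma_toRat, sigma_toRat, ← mul_div_assoc, div_eq_div_iff (toRat_ne_zero hB')
    (toRat_ne_zero hB), ← RatFunc.algebraMap_C, ← map_mul, ← map_mul, ← map_mul] at h
  have h2 := congrArg Polynomial.leadingCoeff (RatFunc.algebraMap_injective ℂ h)
  have hd : (Polynomial.X - Polynomial.C (2 : ℂ)).natDegree ≠ 0 := by simp
  simp only [Polynomial.leadingCoeff_mul, Polynomial.leadingCoeff_comp hd,
    Polynomial.leadingCoeff_X_sub_C, one_pow, mul_one, Polynomial.leadingCoeff_C] at h2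
  have hA0 := Polynomial.leadingCoeff_ne_zero.2 hA
  have hB0 := Polynomial.leadingCoeff_ne_zero.2 hB
  have : (c - 1) * (A.leadingCoeff * B.leadingCoeff) = 0 := by linear_combination -h2
  rcases mul_eq_zero.1 this with h3 | h3
  · exact sub_eq_zero.1 h3
  · exact absurd h3 (mul_ne_zero hA0 hB0)

/-! ### Partial fractions -/

theorem toRat_X_sub_C (l : ℂ) :
    toRat (Polynomial.X - Polynomial.C l) = RatFunc.X - RatFunc.C l := by
  rw [map_sub, RatFunc.algebraMap_X, RatFunc.algebraMap_C]

/-- Dividing `P` by `X - l` splits off the constant `P(l)` over the highest power and lowers the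
exponent of the remaining fraction. -/
theorem toRat_div_pow_mem (S : Submodule ℂ (RatFunc ℂ)) (hpoly : ∀ P : ℂ[X], toRat P ∈ S) (l : ℂ)
    (k : ℕ) (hk : ∀ j, 1 ≤ j → j ≤ k → 1 / (RatFunc.X - RatFunc.C l) ^ j ∈ S) (P : ℂ[X]) :
    toRat P / (RatFunc.X - RatFunc.C l) ^ k ∈ S := by
  induction k generalizing P with
  | zero => simpa using hpoly P
  | succ k ih =>
    have h0 := X_sub_C_ne_zero l
    have hP := Polynomial.modByMonic_add_div P (Polynomial.X - Polynomial.C l)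
    rw [Polynomial.modByMonic_X_sub_C_eq_C_eval] at hP
    have : toRat P / (RatFunc.X - RatFunc.C l) ^ (k + 1) =
        P.eval l • (1 / (RatFunc.X - RatFunc.C l) ^ (k + 1)) +
          toRat (P /ₘ (Polynomial.X - Polynomial.C l)) / (RatFunc.X - RatFunc.C l) ^ k := by
      conv_lhs => rw [← hP]
      rw [map_add, map_mul, toRat_X_sub_C, RatFunc.algebraMap_C, RatFunc.smul_eq_C_mul]
      field_simp
      ring
    rw [this]
    exact S.add_mem (S.smul_mem _ (hk _ (by omega) le_rfl))
      (ih (fun j h1 h2 => hk j h1 (by omega)) _)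

/-- Partial fractions: a subspace that contains the polynomials and the powers
`(h - l) ^ (-k)`, `k ≤ d l`, contains every fraction whose poles have orders bounded by `d`. -/
theorem toRat_div_mem (S : Submodule ℂ (RatFunc ℂ)) (hpoly : ∀ P : ℂ[X], toRat P ∈ S) (d : ℂ → ℕ)
    (hd : ∀ l j, 1 ≤ j → j ≤ d l → 1 / (RatFunc.X - RatFunc.C l) ^ j ∈ S) (n : ℕ) :
    ∀ Q : ℂ[X], Q.natDegree = n → Q ≠ 0 → (∀ l, Q.rootMultiplicity l ≤ d l) →
      ∀ P : ℂ[X], toRat P / toRat Q ∈ S := by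
  induction n using Nat.strong_induction_on with
  | _ n ih =>
  intro Q hn hQ hQd P
  by_cases hdeg : Q.natDegree = 0
  · obtain ⟨c, rfl⟩ := Polynomial.natDegree_eq_zero.1 hdeg
    have : toRat P / toRat (Polynomial.C c) = c⁻¹ • toRat P := by
      rw [RatFunc.algebraMap_C, RatFunc.smul_eq_C_mul, map_inv₀]; ring
    rw [this]
    exact S.smul_mem _ (hpoly P)
  obtain ⟨l, hl⟩ := IsAlgClosed.exists_root Q
    (fun h => hdeg (Polynomial.natDegree_eq_of_degree_eq_some h))
  obtain ⟨Q', hQ', hndvd⟩ := Polynomial.exists_eq_pow_rootMultiplicity_mul_and_not_dvd Q hQ l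
  set k := Q.rootMultiplicity l with hk
  have hkpos : 0 < k := (Polynomial.rootMultiplicity_pos hQ).2 hl
  have hQ'0 : Q' ≠ 0 := by rintro rfl; simp at hndvd
  have hT0 : (Polynomial.X - Polynomial.C l : ℂ[X]) ^ k ≠ 0 :=
    pow_ne_zero _ (Polynomial.X_sub_C_ne_zero l)
  have hcop : IsCoprime ((Polynomial.X - Polynomial.C l : ℂ[X]) ^ k) Q' :=
    IsCoprime.pow_left (((Polynomial.irreducible_X_sub_C l).coprime_iff_not_dvd).2 hndvd)
  -- The Bézout identity splits `P / Q` into a fraction over `Q'`, of smaller degree, and one over a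
  -- power of `h - l`.
  obtain ⟨A, B, hAB⟩ := hcop
  have hdegQ : Q.natDegree = k + Q'.natDegree := by
    conv_lhs => rw [hQ']
    rw [Polynomial.natDegree_mul hT0 hQ'0, Polynomial.natDegree_pow, Polynomial.natDegree_X_sub_C,
      mul_one]
  have hroot : ∀ x, Q'.rootMultiplicity x ≤ d x := fun x => by
    refine le_trans ?_ (hQd x)
    conv_rhs => rw [hQ']
    rw [Polynomial.rootMultiplicity_mul (mul_ne_zero hT0 hQ'0)]
    omega
  have h0 := X_sub_C_ne_zero l
  have h1 := toRat_ne_zero hQ'0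
  have hsum : toRat P / toRat Q = toRat (P * A) / toRat Q' +
      toRat (P * B) / (RatFunc.X - RatFunc.C l) ^ k := by
    have hAB' := congrArg toRat hAB
    simp only [map_add, map_mul, map_pow, map_one, toRat_X_sub_C] at hAB'
    conv_lhs => rw [hQ']
    rw [map_mul, map_pow, toRat_X_sub_C, map_mul, map_mul]
    field_simp
    linear_combination (-toRat P) * hAB'
  rw [hsum]
  refine S.add_mem (ih _ (by omega) Q' rfl hQ'0 hroot _) ?_
  exact toRat_div_pow_mem S hpoly l k (fun j h1 h2 => hd l j h1 (h2.trans (hQd l))) _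

/-- In lowest terms, the order at a root of the denominator is exactly minus its multiplicity, so
the bound on orders bounds the denominator. -/
theorem mem_of_ordAt (S : Submodule ℂ (RatFunc ℂ)) (hpoly : ∀ P : ℂ[X], toRat P ∈ S) (d : ℂ → ℕ)
    (hd : ∀ l j, 1 ≤ j → j ≤ d l → 1 / (RatFunc.X - RatFunc.C l) ^ j ∈ S) {r : RatFunc ℂ}
    (hord : ∀ l, -(d l : ℤ) ≤ ordAt l r) : r ∈ S := by
  rw [← r.num_div_denom]
  refine toRat_div_mem S hpoly d hd _ _ rfl r.denom_ne_zero (fun l => ?_) _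
  have h1 := hord l
  unfold ordAt at h1
  by_cases h2 : r.denom.IsRoot l
  · have h3 : ¬ r.num.IsRoot l := fun h3 => by
      obtain ⟨A, B, hAB⟩ := r.isCoprime_num_denom
      have := congrArg (Polynomial.eval l) hAB
      simp [h2.eq_zero, h3.eq_zero] at this
    rw [Polynomial.rootMultiplicity_eq_zero h3] at h1
    omega
  · rw [Polynomial.rootMultiplicity_eq_zero h2]; omega

/-! ### Normal forms modulo `σ(g) / g` -/

open Classical in
/-- The exponent of `h - l` in the function `uOf c m`. -/
def exponentAt (m : Strip →₀ ℤ) (l : ℂ) : ℤ := if hl : l ∈ Strip then m ⟨l, hl⟩ else 0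

theorem exponentAt_coe (m : Strip →₀ ℤ) (s : Strip) : exponentAt m s = m s := by
  simp [exponentAt]

theorem exponentAt_of_notMem (m : Strip →₀ ℤ) {l : ℂ} (hl : l ∉ Strip) : exponentAt m l = 0 := by
  simp [exponentAt, hl]

theorem uOf_zero : uOf 1 0 = 1 := by simp [uOf]

theorem uOf_mul (c c' : ℂˣ) (m m' : Strip →₀ ℤ) :
    uOf (c * c') (m + m') = uOf c m * uOf c' m' := by
  classical
  unfold uOf
  rw [Finsupp.prod_add_index (fun _ _ => zpow_zero _) (fun _ _ _ _ => zpow_add _ _ _), map_mul]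
  exact mul_mul_mul_comm _ _ _ _

theorem uOf_const (c : ℂˣ) : ((uOf c 0 : (RatFunc ℂ)ˣ) : RatFunc ℂ) = RatFunc.C (c : ℂ) := by
  simp [uOf, RatFunc.algebraMap_eq_C]

theorem uOf_single (s : Strip) (k : ℤ) :
    ((uOf 1 (Finsupp.single s k) : (RatFunc ℂ)ˣ) : RatFunc ℂ) =
      (RatFunc.X - RatFunc.C (s : ℂ)) ^ k := by
  simp [uOf]

theorem uOf_inv (c : ℂˣ) (m : Strip →₀ ℤ) : uOf c⁻¹ (-m) = (uOf c m)⁻¹ := by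
  rw [eq_inv_iff_mul_eq_one, ← uOf_mul]
  simp [uOf_zero]

theorem ordAt_uOf (c : ℂˣ) (m : Strip →₀ ℤ) (l : ℂ) :
    ordAt l (uOf c m : RatFunc ℂ) = exponentAt m l := by
  have hc : uOf c m = uOf c 0 * uOf 1 m := by rw [← uOf_mul]; simp
  rw [hc, Units.val_mul, ordAt_mul l (Units.ne_zero _) (Units.ne_zero _), uOf_const, ordAt_C,
    zero_add]
  clear hc
  induction m using Finsupp.induction_linear with
  | zero => simp [uOf_zero, ordAt_one, exponentAt]
  | add m m' h h' =>
    have := uOf_mul 1 1 m m'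
    rw [mul_one] at this
    rw [this, Units.val_mul, ordAt_mul l (Units.ne_zero _) (Units.ne_zero _), h, h']
    unfold exponentAt
    split_ifs <;> simp
  | single s k =>
    rw [uOf_single, ordAt_zpow l (X_sub_C_ne_zero _), ordAt_X_sub_C]
    unfold exponentAt
    split_ifs with h1 h2 h2
    · subst h1; simp
    · subst h1; exact absurd s.2 h2
    · rw [Finsupp.single_apply, if_neg (fun h => h1 (by rw [h]))]; simp
    · simp

/-- The index of the translate by `2ℤ` of the strip that contains `l`. -/
def stripIndex (l : ℂ) : ℤ := ⌊l.re / 2⌋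

theorem mem_Strip_iff (l : ℂ) : l ∈ Strip ↔ stripIndex l = 0 := by
  rw [stripIndex, Int.floor_eq_zero_iff, Strip, Set.mem_ofPred_eq, Set.mem_Ico]
  constructor <;> rintro ⟨h1, h2⟩ <;> constructor <;> linarith

theorem stripIndex_add (l : ℂ) (n : ℤ) : stripIndex (l + 2 * n) = stripIndex l + n := by
  rw [stripIndex, stripIndex, ← Int.floor_add_intCast]
  congr 1
  simp
  ring

/-- The representative in the strip of the class of `l` modulo `2ℤ`. -/
def stripRep (l : ℂ) : Strip :=
  ⟨l - 2 * stripIndex l, by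
    rw [mem_Strip_iff]
    have := stripIndex_add l (-stripIndex l)
    push_cast at this
    rw [show l - 2 * (stripIndex l : ℂ) = l + 2 * -(stripIndex l : ℂ) by ring, this]
    omega⟩

theorem stripRep_add (l : ℂ) : (stripRep l : ℂ) + 2 * stripIndex l = l := by
  simp [stripRep]

theorem stripRep_add_two_mul (l : ℂ) (n : ℤ) : stripRep (l + 2 * n) = stripRep l := by
  apply Subtype.ext
  simp only [stripRep, stripIndex_add]
  push_cast
  ring

theorem stripIndex_coe (s : Strip) : stripIndex s = 0 := (mem_Strip_iff _).1 s.2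

theorem stripRep_coe (s : Strip) : stripRep s = s := by
  apply Subtype.ext
  simp [stripRep, stripIndex_coe]

/-- The units of `ℂ(h)` of the form `u σ(g) / g` with `u = uOf c m`. -/
def normalizable : Subgroup (RatFunc ℂ)ˣ where
  carrier := {w | ∃ (c : ℂˣ) (m : Strip →₀ ℤ) (g : (RatFunc ℂ)ˣ),
    w * g = uOf c m * Units.map (sigma : RatFunc ℂ →* RatFunc ℂ) g}
  one_mem' := ⟨1, 0, 1, by simp [uOf_zero]⟩
  mul_mem' := by
    rintro w w' ⟨c, m, g, h⟩ ⟨c', m', g', h'⟩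
    refine ⟨c * c', m + m', g * g', ?_⟩
    rw [mul_mul_mul_comm, h, h', uOf_mul, map_mul, mul_mul_mul_comm]
  inv_mem' := by
    rintro w ⟨c, m, g, h⟩
    refine ⟨c⁻¹, -m, g⁻¹, ?_⟩
    rw [uOf_inv, map_inv, ← mul_inv, ← mul_inv, h]

theorem uOf_mem_normalizable (c : ℂˣ) (m : Strip →₀ ℤ) : uOf c m ∈ normalizable :=
  ⟨c, m, 1, by simp⟩

/-- The quotient `σ(w) / w` is itself normalizable, with `c = 1`, `m = 0`, `g = w`. -/
theorem sigma_mem_normalizable_iff (w : (RatFunc ℂ)ˣ) :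
    Units.map (sigma : RatFunc ℂ →* RatFunc ℂ) w ∈ normalizable ↔ w ∈ normalizable := by
  have : Units.map (sigma : RatFunc ℂ →* RatFunc ℂ) w * w⁻¹ ∈ normalizable :=
    ⟨1, 0, w, by rw [uOf_zero, one_mul, inv_mul_cancel_right]⟩
  constructor
  · intro h
    have := normalizable.mul_mem (normalizable.inv_mem this) h
    rwa [mul_inv_rev, inv_inv, inv_mul_cancel_right] at this
  · intro h
    have := normalizable.mul_mem this h
    rwa [inv_mul_cancel_right] at this

/-- Since `σ` sends `h - t` to `h - (t + 2)`, membership depends only on `t` modulo `2ℤ`, and every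
class meets the strip. -/
theorem X_sub_C_mem_normalizable (l : ℂ) :
    Units.mk0 (RatFunc.X - RatFunc.C l) (X_sub_C_ne_zero l) ∈ normalizable := by
  have hstep : ∀ t : ℂ, Units.mk0 (RatFunc.X - RatFunc.C (t + 2)) (X_sub_C_ne_zero (t + 2)) =
      Units.map (sigma : RatFunc ℂ →* RatFunc ℂ)
        (Units.mk0 (RatFunc.X - RatFunc.C t) (X_sub_C_ne_zero t)) := fun t => by
    apply Units.ext
    have hC : sigma (RatFunc.C t) = RatFunc.C t := by
      rw [← RatFunc.algebraMap_eq_C, AlgEquiv.commutes]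
    have h2 : (RatFunc.C (2 : ℂ)) = 2 := map_ofNat _ 2
    simp [sigma_X, hC, h2]
    ring
  have hiff : ∀ t : ℂ,
      Units.mk0 (RatFunc.X - RatFunc.C (t + 2)) (X_sub_C_ne_zero (t + 2)) ∈ normalizable ↔
        Units.mk0 (RatFunc.X - RatFunc.C t) (X_sub_C_ne_zero t) ∈ normalizable := fun t => by
    rw [hstep, sigma_mem_normalizable_iff]
  have hall : ∀ (s : Strip) (n : ℤ), Units.mk0 (RatFunc.X - RatFunc.C ((s : ℂ) + 2 * n))
      (X_sub_C_ne_zero _) ∈ normalizable := fun s n => by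
    induction n using Int.induction_on with
    | zero =>
      have : Units.mk0 (RatFunc.X - RatFunc.C ((s : ℂ) + 2 * (0 : ℤ))) (X_sub_C_ne_zero _) =
          uOf 1 (Finsupp.single s 1) := by
        apply Units.ext
        rw [uOf_single]
        simp
      rw [this]
      exact uOf_mem_normalizable _ _
    | succ n ih =>
      convert (hiff _).2 ih using 4
      push_cast; ring
    | pred n ih =>
      refine (hiff _).1 ?_
      convert ih using 4
      push_cast; ring
  have := hall (stripRep l) (stripIndex l)
  convert this using 4
  exact (stripRep_add l).symm

theorem toRat_mem_normalizable (n : ℕ) : ∀ (A : ℂ[X]) (hA : A ≠ 0), A.natDegree = n →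
    Units.mk0 (toRat A) (toRat_ne_zero hA) ∈ normalizable := by
  induction n with
  | zero =>
    intro A hA hdeg
    obtain ⟨c, rfl⟩ := Polynomial.natDegree_eq_zero.1 hdeg
    have hc : c ≠ 0 := by rintro rfl; simp at hA
    convert uOf_mem_normalizable (Units.mk0 c hc) 0
    apply Units.ext
    rw [uOf_const]
    simp
  | succ n ih =>
    intro A hA hdeg
    obtain ⟨l, hl⟩ := IsAlgClosed.exists_root A (fun h => by
      rw [Polynomial.natDegree_eq_of_degree_eq_some h] at hdeg; simp at hdeg)
    obtain ⟨B, rfl⟩ := Polynomial.dvd_iff_isRoot.2 hl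
    have hB : B ≠ 0 := right_ne_zero_of_mul hA
    rw [Polynomial.natDegree_mul (Polynomial.X_sub_C_ne_zero l) hB,
      Polynomial.natDegree_X_sub_C] at hdeg
    convert normalizable.mul_mem (X_sub_C_mem_normalizable l) (ih B hB (by omega))
    apply Units.ext
    simp

theorem exists_normalForm {w : RatFunc ℂ} (hw : w ≠ 0) :
    ∃ (c : ℂˣ) (m : Strip →₀ ℤ) (g : RatFunc ℂ), g ≠ 0 ∧ w * g = uOf c m * sigma g := by
  obtain ⟨A, B, hA, hB, rfl⟩ := exists_div_of_ne_zero hw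
  obtain ⟨c, m, g, h⟩ := normalizable.mul_mem (toRat_mem_normalizable _ A hA rfl)
    (normalizable.inv_mem (toRat_mem_normalizable _ B hB rfl))
  refine ⟨c, m, g, g.ne_zero, ?_⟩
  simpa [div_eq_mul_inv] using congrArg Units.val h

/-- Off the strip the equation gives `g` equal orders at `l` and `l - 2`. So the order of `g` is
constant along `s, s + 2, …` and along `s - 2, s - 4, …`; both constants vanish because zeros and
poles are finite in number. Comparing orders at `s` yields `m s = m' s`. Then `g` is an eigenvector
of `σ` with eigenvalue `c / c'`, which must be `1`. -/
theorem normalForm_unique {c c' : ℂˣ} {m m' : Strip →₀ ℤ} {g : RatFunc ℂ} (hg : g ≠ 0)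
    (h : uOf c m * g = uOf c' m' * sigma g) : c = c' ∧ m = m' := by
  have hsg : sigma g ≠ 0 := by simpa using hg
  have hord : ∀ l, exponentAt m l + ordAt l g = exponentAt m' l + ordAt (l - 2) g := fun l => by
    have := congrArg (ordAt l) h
    rwa [ordAt_mul l (Units.ne_zero _) hg, ordAt_mul l (Units.ne_zero _) hsg, ordAt_uOf, ordAt_uOf,
      ordAt_sigma] at this
  have hout : ∀ l, stripIndex l ≠ 0 → ordAt l g = ordAt (l - 2) g := fun l hl => by
    have hl' : l ∉ Strip := fun h => hl ((mem_Strip_iff l).1 h)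
    simpa [exponentAt_of_notMem _ hl'] using hord l
  have hm : m = m' := by
    ext s
    have hpos : ∀ n : ℕ, ordAt ((s : ℂ) + n * 2) g = ordAt s g := fun n => by
      induction n with
      | zero => simp
      | succ n ih =>
        rw [hout, ← ih]
        · congr 1; push_cast; ring
        · have := stripIndex_add s (n + 1)
          rw [stripIndex_coe] at this
          push_cast at this ⊢
          rw [mul_comm, this]; omega
    have hneg : ∀ n : ℕ, ordAt ((s : ℂ) - 2 + n * (-2)) g = ordAt ((s : ℂ) - 2) g := fun n => by
      induction n with
      | zero => simp
      | succ n ih =>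
        rw [← ih, hout ((s : ℂ) - 2 + n * (-2))]
        · congr 1; push_cast; ring
        · rw [show (s : ℂ) - 2 + n * (-2) = s + 2 * ((-(n + 1) : ℤ) : ℂ) by push_cast; ring,
            stripIndex_add, stripIndex_coe]
          omega
    obtain ⟨i, hi⟩ := exists_ordAt_add_eq_zero hg (s : ℂ) (two_ne_zero)
    obtain ⟨j, hj⟩ := exists_ordAt_add_eq_zero hg ((s : ℂ) - 2) (z := -2) (by norm_num)
    have := hord s
    rw [exponentAt_coe, exponentAt_coe, ← hpos i, hi, ← hneg j, hj] at this
    simpa using this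
  refine ⟨?_, hm⟩
  subst hm
  have h1 : ∀ c : ℂˣ, ((uOf c m : (RatFunc ℂ)ˣ) : RatFunc ℂ) = RatFunc.C (c : ℂ) * uOf 1 m :=
    fun c => by rw [← uOf_const, ← Units.val_mul, ← uOf_mul]; simp
  rw [h1 c, h1 c'] at h
  have hu : ((uOf 1 m : (RatFunc ℂ)ˣ) : RatFunc ℂ) ≠ 0 := Units.ne_zero _
  have hc' : RatFunc.C (c' : ℂ) ≠ 0 := by simp
  have h2 : RatFunc.C (c : ℂ) * g = RatFunc.C (c' : ℂ) * sigma g := by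
    apply mul_left_cancel₀ hu
    linear_combination h
  have h3 : sigma g = RatFunc.C ((c : ℂ) / c') * g := by
    rw [map_div₀]
    field_simp
    linear_combination -h2
  have h4 := eq_one_of_sigma_eq hg h3
  apply Units.ext
  rwa [div_eq_one_iff_eq (Units.ne_zero _)] at h4

/-! ### Generation of the two algebras and the isomorphism `U / ⟨Σ⟩ ≃ A₁` -/

theorem Weyl.induction {motive : Weyl → Prop} (scalar : ∀ c : ℂ, motive (algebraMap ℂ Weyl c))
    (a : motive Weyl.a) (b : motive Weyl.b) (mul : ∀ x y, motive x → motive y → motive (x * y))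
    (add : ∀ x y, motive x → motive y → motive (x + y)) (x : Weyl) : motive x := by
  obtain ⟨x, rfl⟩ : ∃ y, Weyl.mk y = x := RingQuot.mkAlgHom_surjective ℂ WRel x
  induction x with
  | grade0 c => rw [AlgHom.commutes]; exact scalar c
  | grade1 g => cases g; exacts [a, b]
  | mul x y hx hy => rw [map_mul]; exact mul _ _ hx hy
  | add x y hx hy => rw [map_add]; exact add _ _ hx hy

/-- The odd elements suffice as generators: `e = p²`, `f = -q²`, `h = pq + qp`. -/
theorem U.induction {motive : U → Prop} (scalar : ∀ c : ℂ, motive (algebraMap ℂ U c))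
    (p : motive U.p) (q : motive U.q) (mul : ∀ x y, motive x → motive y → motive (x * y))
    (add : ∀ x y, motive x → motive y → motive (x + y)) (x : U) : motive x := by
  obtain ⟨x, rfl⟩ : ∃ y, U.mk y = x := RingQuot.mkAlgHom_surjective ℂ URel x
  induction x with
  | grade0 c => rw [AlgHom.commutes]; exact scalar c
  | grade1 g =>
    cases g with
    | p => exact p
    | q => exact q
    | e => change motive U.e; rw [← U.p_mul_p]; exact mul _ _ p p
    | h => change motive U.h; rw [← U.p_mul_q]; exact add _ _ (mul _ _ p q) (mul _ _ q p)
    | f =>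
      change motive U.f
      have : U.f = algebraMap ℂ U (-1) * (U.q * U.q) := by rw [U.q_mul_q]; simp
      rw [this]
      exact mul _ _ (scalar _) (mul _ _ q q)
  | mul x y hx hy => rw [map_mul]; exact mul _ _ hx hy
  | add x y hx hy => rw [map_add]; exact add _ _ hx hy

theorem Theta_gen (g : Gen) : Theta (U.gen g) = thetaGen g := by
  unfold Theta U.gen U.mk
  exact (RingQuot.liftAlgHom_mkAlgHom_apply _ _ _ _).trans (FreeAlgebra.lift_ι_apply _ _)

theorem Theta_p : Theta U.p = invSqrtTwo • Weyl.a := Theta_gen Gen.p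
theorem Theta_q : Theta U.q = -(invSqrtTwo • Weyl.b) := Theta_gen Gen.q
theorem Theta_h : Theta U.h = -((1 / 2 : ℂ) • (Weyl.a * Weyl.b + Weyl.b * Weyl.a)) :=
  Theta_gen Gen.h

theorem two_invSqrtTwo_mul : 2 * invSqrtTwo * invSqrtTwo = 1 := by
  rw [mul_assoc, invSqrtTwo_mul_self]; norm_num

theorem invSqrtTwo_ne_zero : invSqrtTwo ≠ 0 := fun h => by
  simpa [h] using two_invSqrtTwo_mul

theorem Theta_scasimir : Theta U.scasimir = 0 := by
  unfold U.scasimir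
  rw [map_add, map_sub, map_mul, map_mul, Theta_p, Theta_q, AlgHom.commutes,
    Algebra.algebraMap_eq_smul_one]
  simp only [mul_neg, neg_mul, smul_mul_smul_comm, invSqrtTwo_mul_self, Weyl.a_mul_b]
  module

theorem Weyl.lift_a {A : Type*} [Ring A] [Algebra ℂ A] (x y : A) (hxy : x * y - y * x = 1) :
    Weyl.lift x y hxy Weyl.a = x := by
  unfold Weyl.lift Weyl.a Weyl.mk
  exact (RingQuot.liftAlgHom_mkAlgHom_apply _ _ _ _).trans (FreeAlgebra.lift_ι_apply _ _)

theorem Weyl.lift_b {A : Type*} [Ring A] [Algebra ℂ A] (x y : A) (hxy : x * y - y * x = 1) :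
    Weyl.lift x y hxy Weyl.b = y := by
  unfold Weyl.lift Weyl.b Weyl.mk
  exact (RingQuot.liftAlgHom_mkAlgHom_apply _ _ _ _).trans (FreeAlgebra.lift_ι_apply _ _)

theorem Theta_surjective : Function.Surjective Theta := fun x => by
  induction x using Weyl.induction with
  | scalar c => exact ⟨algebraMap ℂ U c, AlgHom.commutes _ _⟩
  | a => exact ⟨(2 * invSqrtTwo) • U.p, by rw [map_smul, Theta_p, smul_smul, two_invSqrtTwo_mul,
      one_smul]⟩
  | b => exact ⟨-((2 * invSqrtTwo) • U.q), by rw [map_neg, map_smul, Theta_q, smul_neg, neg_neg,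
      smul_smul, two_invSqrtTwo_mul, one_smul]⟩
  | mul x y hx hy =>
    obtain ⟨x, rfl⟩ := hx
    obtain ⟨y, rfl⟩ := hy
    exact ⟨x * y, map_mul _ _ _⟩
  | add x y hx hy =>
    obtain ⟨x, rfl⟩ := hx
    obtain ⟨y, rfl⟩ := hy
    exact ⟨x + y, map_add _ _ _⟩

instance : RingHomSurjective (Theta : U →+* Weyl) := ⟨Theta_surjective⟩

theorem ringCon_span_le_ker {S : Type*} [Ring S] (f : U →+* S) (hf : f U.scasimir = 0) :
    (TwoSidedIdeal.span {U.scasimir}).ringCon ≤ RingCon.ker f := by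
  have : TwoSidedIdeal.span {U.scasimir} ≤ TwoSidedIdeal.ker f :=
    TwoSidedIdeal.span_le.2 (by simpa [TwoSidedIdeal.mem_ker] using hf)
  exact fun x y hxy => TwoSidedIdeal.ringCon_le_iff.1 this hxy

theorem toUBar_scasimir : toUBar U.scasimir = 0 := by
  have h : U.scasimir ∈ TwoSidedIdeal.span {U.scasimir} := TwoSidedIdeal.subset_span rfl
  rw [TwoSidedIdeal.mem_iff] at h
  exact (RingCon.eq _).2 h

theorem toUBar_surjective : Function.Surjective toUBar := RingCon.mkₐ_surjective (α := ℂ) _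

/-- The homomorphism `A₁ → U / ⟨Σ⟩` inverse to the one induced by `Θ`. -/
def weylToUBar : Weyl →ₐ[ℂ] UBar :=
  -- The constant `2 * invSqrtTwo` is `√2`, the inverse of the scalar in `Θ(p)`. The commutator of
  -- the two images is `-2 (pq - qp)`, which is `1` once `Σ = 0`.
  Weyl.lift ((2 * invSqrtTwo) • toUBar U.p) (-((2 * invSqrtTwo) • toUBar U.q)) (by
    have h : toUBar (U.p * U.q - U.q * U.p + algebraMap ℂ U (1 / 2)) = 0 := toUBar_scasimir
    rw [map_add, map_sub, map_mul, map_mul, AlgHom.commutes, Algebra.algebraMap_eq_smul_one] at h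
    have h2 : 2 * invSqrtTwo * (2 * invSqrtTwo) = 2 := by
      linear_combination 2 * two_invSqrtTwo_mul
    rw [mul_neg, neg_mul, smul_mul_smul_comm, smul_mul_smul_comm, h2]
    have h3 : toUBar U.p * toUBar U.q - toUBar U.q * toUBar U.p = -((1 / 2 : ℂ) • 1) :=
      eq_neg_of_add_eq_zero_left h
    calc _ = (-2 : ℂ) • (toUBar U.p * toUBar U.q - toUBar U.q * toUBar U.p) := by module
      _ = 1 := by rw [h3]; module)

theorem weylToUBar_Theta (x : U) : weylToUBar (Theta x) = toUBar x := by
  induction x using U.induction with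
  | scalar c => simp only [AlgHom.commutes]
  | p =>
    rw [Theta_p, map_smul, weylToUBar, Weyl.lift_a, smul_smul, mul_comm, two_invSqrtTwo_mul,
      one_smul]
  | q =>
    rw [Theta_q, map_neg, map_smul, weylToUBar, Weyl.lift_b, smul_neg, neg_neg, smul_smul, mul_comm,
      two_invSqrtTwo_mul, one_smul]
  | mul x y hx hy => simp only [map_mul, hx, hy]
  | add x y hx hy => simp only [map_add, hx, hy]

theorem exists_UBar_algEquiv : ∃ φ : UBar ≃ₐ[ℂ] Weyl, ∀ x : U, φ (toUBar x) = Theta x := by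
  let φ : UBar →ₐ[ℂ] Weyl := RingCon.liftₐ _ Theta (ringCon_span_le_ker _ Theta_scasimir)
  have hφ : ∀ x : U, φ (toUBar x) = Theta x := fun x => rfl
  refine ⟨AlgEquiv.ofBijective φ ⟨?_, fun w => ?_⟩, hφ⟩
  · apply Function.LeftInverse.injective (g := weylToUBar)
    intro y
    obtain ⟨x, rfl⟩ := toUBar_surjective y
    rw [hφ, weylToUBar_Theta]
  · obtain ⟨x, rfl⟩ := Theta_surjective w
    exact ⟨toUBar x, hφ x⟩

theorem exists_UBar_module {M : Type*} [AddCommGroup M] [Module U M]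
    (hM : ∀ v : M, U.scasimir • v = 0) :
    ∃ _ : Module UBar M, ∀ (x : U) (v : M), toUBar x • v = x • v := by
  let f : UBar →+* AddMonoid.End M := RingCon.lift _ (Module.toAddMonoidEnd U M)
    (ringCon_span_le_ker _ (by ext v; exact hM v))
  exact ⟨Module.compHom M f, fun x v => rfl⟩

/-! ### The action on `N_u` -/

/-- The identification of the space `N_u` with `ℂ(h)`. -/
def N.of (u : (RatFunc ℂ)ˣ) : RatFunc ℂ ≃ₗ[ℂ] N u := LinearEquiv.refl ℂ _

theorem a_smul_of (u : (RatFunc ℂ)ˣ) (r : RatFunc ℂ) :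
    Weyl.a • N.of u r = N.of u (sigma r * u) := by
  change weylAct u Weyl.a r = _
  rw [weylAct, Weyl.lift_a]
  rfl

theorem b_smul_of (u : (RatFunc ℂ)ˣ) (r : RatFunc ℂ) :
    Weyl.b • N.of u r =
      N.of u (-((1 / 2 : ℂ) • sigma.symm (RatFunc.X * r * ((u⁻¹ : (RatFunc ℂ)ˣ) : RatFunc ℂ)))) := by
  change weylAct u Weyl.b r = _
  rw [weylAct, Weyl.lift_b]
  rfl

theorem sigma_smul (c : ℂ) (r : RatFunc ℂ) : sigma (c • r) = c • sigma r := by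
  rw [Algebra.smul_def, Algebra.smul_def, map_mul, AlgEquiv.commutes]

/-- The element `2 h - 1` of `U`, that acts on `N_u` as multiplication by the variable. -/
def U.weight : U := 2 * U.h - 1

theorem Theta_weight : Theta U.weight = -((2 : ℂ) • (Weyl.a * Weyl.b)) := by
  have h2 : (2 : U) = algebraMap ℂ U 2 := (map_ofNat _ 2).symm
  rw [U.weight, h2, ← Algebra.smul_def, map_sub, map_smul, Theta_h, map_one, Weyl.a_mul_b]
  module

theorem Theta_weight_smul_of (u : (RatFunc ℂ)ˣ) (r : RatFunc ℂ) :
    Theta U.weight • N.of u r = N.of u (RatFunc.X * r) := by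
  rw [Theta_weight, neg_smul, smul_assoc, mul_smul, b_smul_of, a_smul_of, ← map_smul, ← map_neg]
  congr 1
  rw [map_neg, sigma_smul, AlgEquiv.apply_symm_apply, neg_mul, smul_mul_assoc, mul_assoc, mul_assoc,
    Units.inv_mul, mul_one]
  module

theorem Theta_aeval_smul_of (u : (RatFunc ℂ)ˣ) (P : ℂ[X]) (r : RatFunc ℂ) :
    Theta (Polynomial.aeval U.weight P) • N.of u r = N.of u (toRat P * r) := by
  induction P using Polynomial.induction_on generalizing r with
  | C c =>
    rw [Polynomial.aeval_C, AlgHom.commutes, algebraMap_smul, RatFunc.algebraMap_C,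
      ← RatFunc.smul_eq_C_mul, map_smul]
  | add P Q hP hQ => rw [map_add, map_add, add_smul, hP, hQ, map_add, add_mul, map_add]
  | monomial n c h =>
    have : (Polynomial.C c * Polynomial.X ^ (n + 1) : ℂ[X]) =
        Polynomial.C c * Polynomial.X ^ n * Polynomial.X := by ring
    rw [this, map_mul, map_mul (algebraMap ℂ[X] (RatFunc ℂ)), map_mul, mul_smul,
      Polynomial.aeval_X, Theta_weight_smul_of, h, RatFunc.algebraMap_X, mul_assoc]

theorem toRat_mul_mem {u : (RatFunc ℂ)ˣ} (V : Submodule Weyl (N u)) (P : ℂ[X]) {r : RatFunc ℂ}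
    (hr : N.of u r ∈ V) : N.of u (toRat P * r) ∈ V := by
  rw [← Theta_aeval_smul_of]
  exact V.smul_mem _ hr

/-- A `ℂ`-subspace of `N_u` that is stable under `a` and `b` is a submodule. -/
def weylSubmodule {u : (RatFunc ℂ)ˣ} (S : Submodule ℂ (N u)) (ha : ∀ r ∈ S, Weyl.a • r ∈ S)
    (hb : ∀ r ∈ S, Weyl.b • r ∈ S) : Submodule Weyl (N u) where
  __ := S
  smul_mem' w r hr := by
    change w • r ∈ S
    replace hr : r ∈ S := hr
    induction w using Weyl.induction generalizing r with
    | scalar c => rw [algebraMap_smul]; exact S.smul_mem c hr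
    | a => exact ha r hr
    | b => exact hb r hr
    | mul x y hx hy => rw [mul_smul]; exact hx _ (hy _ hr)
    | add x y hx hy => rw [add_smul]; exact S.add_mem (hx _ hr) (hy _ hr)

/-- The rational function that corresponds to `a • r`. -/
def aFun (u : (RatFunc ℂ)ˣ) (r : RatFunc ℂ) : RatFunc ℂ := sigma r * u

/-- The rational function that corresponds to `-2 b • r`. -/
def bFun (u : (RatFunc ℂ)ˣ) (r : RatFunc ℂ) : RatFunc ℂ :=
  sigma.symm (RatFunc.X * r * ((u⁻¹ : (RatFunc ℂ)ˣ) : RatFunc ℂ))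

theorem aFun_ne_zero (u : (RatFunc ℂ)ˣ) {r : RatFunc ℂ} (hr : r ≠ 0) : aFun u r ≠ 0 :=
  mul_ne_zero (by simpa using hr) u.ne_zero

theorem bFun_ne_zero (u : (RatFunc ℂ)ˣ) {r : RatFunc ℂ} (hr : r ≠ 0) : bFun u r ≠ 0 := by
  simpa [bFun, RatFunc.X_ne_zero] using hr

theorem aFun_mem {u : (RatFunc ℂ)ˣ} (V : Submodule Weyl (N u)) {r : RatFunc ℂ}
    (hr : N.of u r ∈ V) : N.of u (aFun u r) ∈ V := by
  rw [aFun, ← a_smul_of]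
  exact V.smul_mem _ hr

theorem bFun_mem {u : (RatFunc ℂ)ˣ} (V : Submodule Weyl (N u)) {r : RatFunc ℂ}
    (hr : N.of u r ∈ V) : N.of u (bFun u r) ∈ V := by
  have : N.of u (bFun u r) = algebraMap ℂ Weyl (-2) • Weyl.b • N.of u r := by
    rw [b_smul_of, algebraMap_smul, ← map_smul, bFun]
    congr 1
    module
  rw [this]
  exact V.smul_mem _ (V.smul_mem _ hr)

theorem ordAt_aFun (c : ℂˣ) (m : Strip →₀ ℤ) (l : ℂ) {r : RatFunc ℂ} (hr : r ≠ 0) :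
    ordAt l (aFun (uOf c m) r) = ordAt (l - 2) r + exponentAt m l := by
  rw [aFun, ordAt_mul l (by simpa using hr) (Units.ne_zero _), ordAt_sigma, ordAt_uOf]

open Classical in
theorem ordAt_bFun (c : ℂˣ) (m : Strip →₀ ℤ) (l : ℂ) {r : RatFunc ℂ} (hr : r ≠ 0) :
    ordAt l (bFun (uOf c m) r) =
      ordAt (l + 2) r - exponentAt m (l + 2) + if l + 2 = 0 then 1 else 0 := by
  rw [bFun, ordAt_sigma_symm, ordAt_mul _ (mul_ne_zero RatFunc.X_ne_zero hr) (Units.ne_zero _),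
    ordAt_mul _ RatFunc.X_ne_zero hr, Units.val_inv_eq_inv_val, ordAt_inv _ (Units.ne_zero _),
    ordAt_uOf, ordAt_X]
  split_ifs <;> ring

/-! ### The submodule `D_u` -/

open Classical in
/-- The largest order of a pole at `l` of the elements of `D_u`. -/
def poleBound (m : Strip →₀ ℤ) (l : ℂ) : ℕ :=
  -- Poles to the right of, or in, the strip come from negative exponents, those to the left from
  -- positive ones. On the class of `0` the factor `h` in the action of `b` cancels one order.
  -- `toNat` turns a negative bound into `0`: no pole allowed.
  (if 0 ≤ stripIndex l then -m (stripRep l)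
    else if (stripRep l : ℂ) = 0 then m (stripRep l) - 1 else m (stripRep l)).toNat

theorem stripIndex_sub_two (l : ℂ) : stripIndex (l - 2) = stripIndex l - 1 := by
  have := stripIndex_add l (-1)
  rw [← sub_eq_add_neg] at this
  rw [← this]
  congr 1
  push_cast; ring

theorem stripRep_sub_two (l : ℂ) : stripRep (l - 2) = stripRep l := by
  rw [← stripRep_add_two_mul l (-1)]
  congr 1
  push_cast; ring

theorem exponentAt_eq (m : Strip →₀ ℤ) (l : ℂ) :
    exponentAt m l = if stripIndex l = 0 then m (stripRep l) else 0 := by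
  split_ifs with h
  · have hl := (mem_Strip_iff l).2 h
    rw [exponentAt, dif_pos hl, ← stripRep_coe ⟨l, hl⟩]
  · exact exponentAt_of_notMem m (fun h' => h ((mem_Strip_iff l).1 h'))

/-- This is what stability under `a` requires. The bound changes along a class only between strip
indices `-1` and `0`, exactly where `u` contributes its exponent. -/
theorem poleBound_sub_two_le (m : Strip →₀ ℤ) (l : ℂ) :
    (poleBound m (l - 2) : ℤ) ≤ poleBound m l + exponentAt m l := by
  rw [exponentAt_eq, poleBound, poleBound, stripIndex_sub_two, stripRep_sub_two]
  split_ifs <;> omega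

-- The counterpart for `b`; the correction at `l = 0` is the zero supplied by the factor `h`.
open Classical in
theorem poleBound_add_le (m : Strip →₀ ℤ) (l : ℂ) :
    (poleBound m l + exponentAt m l - if l = 0 then 1 else 0 : ℤ) ≤ poleBound m (l - 2) := by
  have h0 : stripIndex l = 0 → ((stripRep l : ℂ) = 0 ↔ l = 0) := fun h => by
    simp [stripRep, h]
  rw [exponentAt_eq, poleBound, poleBound, stripIndex_sub_two, stripRep_sub_two]
  by_cases h : stripIndex l = 0
  · simp only [h0 h]
    split_ifs <;> omega
  · split_ifs <;> omega

theorem one_div_pow_mem_span (m : Strip →₀ ℤ) (l : ℂ) (j : ℕ) (h1 : 1 ≤ j)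
    (h2 : j ≤ poleBound m l) :
    1 / (RatFunc.X - RatFunc.C l) ^ j ∈ Submodule.span ℂ (dGenerators m) := by
  apply Submodule.subset_span
  have hl := stripRep_add l
  unfold poleBound at h2
  split_ifs at h2 with h3 h4
  · refine Or.inl (Or.inl (Or.inr ⟨stripRep l, by omega, (stripIndex l).toNat, j, h1, by omega, ?_⟩))
    have : (((stripIndex l).toNat : ℤ) : ℂ) = stripIndex l := by rw [Int.toNat_of_nonneg h3]
    rw [Int.cast_natCast] at this
    rw [this, hl]
  · refine Or.inr ⟨stripRep l, h4, by omega, (-stripIndex l).toNat, j, by omega, h1, by omega, ?_⟩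
    have : (((-stripIndex l).toNat : ℤ) : ℂ) = -stripIndex l := by
      rw [Int.toNat_of_nonneg (by omega)]; push_cast; rfl
    rw [Int.cast_natCast] at this
    rw [h4, zero_add] at hl
    rw [this, mul_neg, hl, map_neg, sub_eq_add_neg]
  · refine Or.inl (Or.inr ⟨stripRep l, h4, by omega, (-stripIndex l).toNat, j, by omega, h1,
      by omega, ?_⟩)
    have : (((-stripIndex l).toNat : ℤ) : ℂ) = -stripIndex l := by
      rw [Int.toNat_of_nonneg (by omega)]; push_cast; rfl
    rw [Int.cast_natCast] at this
    rw [this, mul_neg, sub_neg_eq_add, hl]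

theorem stripIndex_coe_add (s : Strip) (n : ℤ) : stripIndex ((s : ℂ) + 2 * n) = n := by
  rw [stripIndex_add, stripIndex_coe, zero_add]

theorem stripRep_coe_add (s : Strip) (n : ℤ) : stripRep ((s : ℂ) + 2 * n) = s := by
  rw [stripRep_add_two_mul, stripRep_coe]

theorem exists_of_mem_dGenerators {m : Strip →₀ ℤ} {r : RatFunc ℂ} (hr : r ∈ dGenerators m) :
    (∃ P : ℂ[X], r = toRat P) ∨
      ∃ (l : ℂ) (k : ℕ), 1 ≤ k ∧ k ≤ poleBound m l ∧ r = 1 / (RatFunc.X - RatFunc.C l) ^ k := by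
  rcases hr with ((hP | ⟨s, hs, i, k, h1, h2, rfl⟩) | ⟨s, hs0, hs, i, k, hi, h1, h2, rfl⟩) |
    ⟨s, hs0, hs, i, k, hi, h1, h2, rfl⟩
  · exact Or.inl hP
  · refine Or.inr ⟨_, k, h1, ?_, rfl⟩
    rw [← Int.cast_natCast i, poleBound, stripIndex_coe_add, stripRep_coe_add, if_pos (by omega)]
    omega
  · refine Or.inr ⟨_, k, h1, ?_, rfl⟩
    rw [show (s : ℂ) - 2 * (i : ℂ) = s + 2 * ((-i : ℤ) : ℂ) by push_cast; ring, poleBound,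
      stripIndex_coe_add, stripRep_coe_add, if_neg (by omega), if_neg hs0]
    omega
  · refine Or.inr ⟨(s : ℂ) + 2 * ((-i : ℤ) : ℂ), k, h1, ?_, ?_⟩
    · rw [poleBound, stripIndex_coe_add, stripRep_coe_add, if_neg (by omega), if_pos hs0]
      omega
    · rw [hs0]
      simp

/-- Generators are enough: stability of the span under `a` and `b` follows by linearity, so orders
of sums never have to be estimated. -/
theorem neg_poleBound_le_ordAt {m : Strip →₀ ℤ} {r : RatFunc ℂ} (hr : r ∈ dGenerators m) (l : ℂ) :
    -(poleBound m l : ℤ) ≤ ordAt l r := by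
  rcases exists_of_mem_dGenerators hr with ⟨P, rfl⟩ | ⟨t, k, h1, h2, rfl⟩
  · rw [ordAt_toRat]; omega
  · rw [one_div, ordAt_inv l (pow_ne_zero k (X_sub_C_ne_zero t)), ordAt_pow l (X_sub_C_ne_zero t),
      ordAt_X_sub_C]
    split_ifs with h
    · subst h; omega
    · omega

theorem mem_span_dGenerators (m : Strip →₀ ℤ) {r : RatFunc ℂ}
    (hr : ∀ l, -(poleBound m l : ℤ) ≤ ordAt l r) : r ∈ Submodule.span ℂ (dGenerators m) :=
  mem_of_ordAt _ (fun P => Submodule.subset_span (Or.inl (Or.inl (Or.inl ⟨P, rfl⟩)))) _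
    (one_div_pow_mem_span m) hr

theorem aFun_mem_span (c : ℂˣ) (m : Strip →₀ ℤ) {r : RatFunc ℂ} (hr : r ∈ dGenerators m) :
    aFun (uOf c m) r ∈ Submodule.span ℂ (dGenerators m) := by
  rcases eq_or_ne r 0 with rfl | h0
  · simp [aFun]
  refine mem_span_dGenerators m fun l => ?_
  rw [ordAt_aFun c m l h0]
  have := neg_poleBound_le_ordAt hr (l - 2)
  have := poleBound_sub_two_le m l
  omega

theorem bFun_mem_span (c : ℂˣ) (m : Strip →₀ ℤ) {r : RatFunc ℂ} (hr : r ∈ dGenerators m) :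
    bFun (uOf c m) r ∈ Submodule.span ℂ (dGenerators m) := by
  rcases eq_or_ne r 0 with rfl | h0
  · simp [bFun]
  refine mem_span_dGenerators m fun l => ?_
  rw [ordAt_bFun c m l h0]
  have h1 := neg_poleBound_le_ordAt hr (l + 2)
  have h2 := poleBound_add_le m (l + 2)
  rw [add_sub_cancel_right] at h2
  split_ifs at h2 ⊢ <;> omega

theorem of_mem_D_iff (c : ℂˣ) (m : Strip →₀ ℤ) (r : RatFunc ℂ) :
    N.of (uOf c m) r ∈ D c m ↔ r ∈ Submodule.span ℂ (dGenerators m) := Iff.rfl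

/-- The subspace `D_u` as a module over the Weyl algebra. -/
def DWeyl (c : ℂˣ) (m : Strip →₀ ℤ) : Submodule Weyl (N (uOf c m)) :=
  weylSubmodule (D c m)
    (fun r hr => by
      obtain ⟨r, rfl⟩ := (N.of (uOf c m)).surjective r
      rw [of_mem_D_iff] at hr
      rw [a_smul_of, of_mem_D_iff]
      change aFun _ r ∈ _
      induction hr using Submodule.span_induction with
      | mem r hr => exact aFun_mem_span c m hr
      | zero => simp [aFun]
      | add r s _ _ hr hs => rw [aFun, map_add, add_mul]; exact Submodule.add_mem _ hr hs
      | smul t r _ hr => rw [aFun, sigma_smul, smul_mul_assoc]; exact Submodule.smul_mem _ _ hr)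
    (fun r hr => by
      obtain ⟨r, rfl⟩ := (N.of (uOf c m)).surjective r
      rw [of_mem_D_iff] at hr
      rw [b_smul_of, of_mem_D_iff]
      refine Submodule.neg_mem _ (Submodule.smul_mem _ _ ?_)
      change bFun _ r ∈ _
      induction hr using Submodule.span_induction with
      | mem r hr => exact bFun_mem_span c m hr
      | zero => simp [bFun]
      | add r s _ _ hr hs =>
        rw [bFun, mul_add, add_mul, map_add]; exact Submodule.add_mem _ hr hs
      | smul t r _ hr =>
        have : bFun (uOf c m) (t • r) = t • bFun (uOf c m) r := by
          apply sigma.injective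
          rw [sigma_smul]
          simp [bFun]
        rw [this]; exact Submodule.smul_mem _ _ hr)

theorem of_mem_DWeyl_iff (c : ℂˣ) (m : Strip →₀ ℤ) (r : RatFunc ℂ) :
    N.of (uOf c m) r ∈ DWeyl c m ↔ r ∈ Submodule.span ℂ (dGenerators m) := Iff.rfl

theorem toRat_mem_DWeyl (c : ℂˣ) (m : Strip →₀ ℤ) (P : ℂ[X]) :
    N.of (uOf c m) (toRat P) ∈ DWeyl c m :=
  Submodule.subset_span (Or.inl (Or.inl (Or.inl ⟨P, rfl⟩)))

/-! ### Minimality of `D_u` -/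

theorem toRat_denom_mul (r : RatFunc ℂ) : toRat r.denom * r = toRat r.num := by
  have := r.num_div_denom
  rw [div_eq_iff (toRat_ne_zero r.denom_ne_zero)] at this
  rw [this, mul_comm]

theorem eval_num_ne_zero {r : RatFunc ℂ} (h0 : r ≠ 0) {l : ℂ} (hl : ordAt l r ≤ 0) :
    r.num.eval l ≠ 0 := fun h => by
  have h1 : 0 < r.num.rootMultiplicity l :=
    (Polynomial.rootMultiplicity_pos (RatFunc.num_ne_zero h0)).2 h
  have h2 : r.denom.eval l ≠ 0 := fun h2 => by
    obtain ⟨A, B, hAB⟩ := r.isCoprime_num_denom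
    have := congrArg (Polynomial.eval l) hAB
    simp [h, h2] at this
  have h3 := Polynomial.rootMultiplicity_eq_zero (p := r.denom) (x := l) h2
  unfold ordAt at hl
  omega

section Minimal

variable {u : (RatFunc ℂ)ˣ} (V : Submodule Weyl (N u))

theorem iterate_aFun_mem {r : RatFunc ℂ} (hr : N.of u r ∈ V) (n : ℕ) :
    N.of u ((aFun u)^[n] r) ∈ V := by
  induction n with
  | zero => exact hr
  | succ n ih => rw [Function.iterate_succ_apply']; exact aFun_mem V ih

theorem iterate_bFun_mem {r : RatFunc ℂ} (hr : N.of u r ∈ V) (n : ℕ) :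
    N.of u ((bFun u)^[n] r) ∈ V := by
  induction n with
  | zero => exact hr
  | succ n ih => rw [Function.iterate_succ_apply']; exact bFun_mem V ih

theorem iterate_aFun_ne_zero {r : RatFunc ℂ} (hr : r ≠ 0) (n : ℕ) : (aFun u)^[n] r ≠ 0 := by
  induction n with
  | zero => exact hr
  | succ n ih => rw [Function.iterate_succ_apply']; exact aFun_ne_zero u ih

theorem iterate_bFun_ne_zero {r : RatFunc ℂ} (hr : r ≠ 0) (n : ℕ) : (bFun u)^[n] r ≠ 0 := by
  induction n with
  | zero => exact hr
  | succ n ih => rw [Function.iterate_succ_apply']; exact bFun_ne_zero u ih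

/-- A submodule is stable under multiplication by polynomials, so the denominator of `r` can be
cleared; the reduced numerator does not vanish at `l`. -/
theorem exists_toRat_mem_of_ordAt_nonpos {r : RatFunc ℂ} (h0 : r ≠ 0) (hr : N.of u r ∈ V) {l : ℂ}
    (hl : ordAt l r ≤ 0) : ∃ P : ℂ[X], N.of u (toRat P) ∈ V ∧ P.eval l ≠ 0 := by
  refine ⟨r.num, ?_, eval_num_ne_zero h0 hl⟩
  rw [← toRat_denom_mul]
  exact toRat_mul_mem V _ hr

/-- The polynomials in `V` form an ideal of `ℂ[X]`. Having no common zero, it is the unit ideal. -/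
theorem toRat_mem_of_forall (h : ∀ l, ∃ P : ℂ[X], N.of u (toRat P) ∈ V ∧ P.eval l ≠ 0) (P : ℂ[X]) :
    N.of u (toRat P) ∈ V := by
  let I : Ideal ℂ[X] :=
    { carrier := {P | N.of u (toRat P) ∈ V}
      add_mem' := fun {P Q} hP hQ => by
        change N.of u (toRat (P + Q)) ∈ V
        rw [map_add, map_add]; exact V.add_mem hP hQ
      zero_mem' := by change N.of u (toRat 0) ∈ V; rw [map_zero, map_zero]; exact V.zero_mem
      smul_mem' := fun P Q hQ => by
        change N.of u (toRat (P * Q)) ∈ V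
        rw [map_mul]; exact toRat_mul_mem V P hQ }
  have hI : I = ⊤ := by
    by_contra hne
    set g := Submodule.IsPrincipal.generator I with hg
    have hspan : Ideal.span {g} = I := I.span_singleton_generator
    have hdvd : ∀ Q, N.of u (toRat Q) ∈ V → g ∣ Q := fun Q hQ =>
      Ideal.mem_span_singleton.1 (hspan ▸ (show Q ∈ I from hQ))
    have hdeg : g.degree ≠ 0 := fun hd => by
      apply hne
      rw [← hspan, Ideal.span_singleton_eq_top]
      exact Polynomial.isUnit_iff_degree_eq_zero.2 hd
    obtain ⟨l, hl⟩ := IsAlgClosed.exists_root g hdeg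
    obtain ⟨Q, hQ, hQl⟩ := h l
    exact hQl (Polynomial.eval_eq_zero_of_dvd_of_eval_eq_zero (hdvd Q hQ) hl)
  exact (hI ▸ Submodule.mem_top : P ∈ I)

/-- Put `s = (h - l)^k r`. Its numerator is prime to `h - l`, and dividing the Bézout identity `A (h
- l)^k + B s.num = 1` by `(h - l)^k` writes the wanted fraction as `A + B s.denom r`. -/
theorem one_div_pow_mem_of_ordAt (hpoly : ∀ P : ℂ[X], N.of u (toRat P) ∈ V) {r : RatFunc ℂ}
    (h0 : r ≠ 0) (hr : N.of u r ∈ V) (l : ℂ) (k : ℕ) (hl : ordAt l r ≤ -k) :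
    N.of u (1 / (RatFunc.X - RatFunc.C l) ^ k) ∈ V := by
  have hX := X_sub_C_ne_zero l
  set s := (RatFunc.X - RatFunc.C l) ^ k * r with hs
  have hs0 : s ≠ 0 := mul_ne_zero (pow_ne_zero k hX) h0
  have hsl : ordAt l s ≤ 0 := by
    rw [hs, ordAt_mul l (pow_ne_zero k hX) h0, ordAt_pow l hX, ordAt_X_sub_C, if_pos rfl]
    omega
  have hnum := eval_num_ne_zero hs0 hsl
  have hcop : IsCoprime ((Polynomial.X - Polynomial.C l : ℂ[X]) ^ k) s.num :=
    IsCoprime.pow_left (((Polynomial.irreducible_X_sub_C l).coprime_iff_not_dvd).2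
      (fun h => hnum (Polynomial.dvd_iff_isRoot.1 h)))
  obtain ⟨A, B, hAB⟩ := hcop
  have hAB' := congrArg toRat hAB
  simp only [map_add, map_mul, map_pow, map_one, toRat_X_sub_C] at hAB'
  have : 1 / (RatFunc.X - RatFunc.C l) ^ k = toRat A + toRat (B * s.denom) * r := by
    rw [div_eq_iff (pow_ne_zero k hX), ← hAB', ← toRat_denom_mul, hs, map_mul]
    ring
  rw [this, map_add]
  exact V.add_mem (hpoly A) (toRat_mul_mem V _ hr)

end Minimal

/-- To the left of the strip `u` has neither zeros nor poles, so `a` merely translates orders. -/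
theorem ordAt_iterate_aFun (c : ℂˣ) (m : Strip →₀ ℤ) {r : RatFunc ℂ} (h0 : r ≠ 0) {l : ℂ}
    (hl : stripIndex l < 0) (n : ℕ) :
    ordAt l ((aFun (uOf c m))^[n] r) = ordAt (l + n * (-2)) r := by
  induction n generalizing l with
  | zero => simp
  | succ n ih =>
    rw [Function.iterate_succ_apply', ordAt_aFun c m l (iterate_aFun_ne_zero h0 n), ih,
      exponentAt_eq, if_neg (by omega), add_zero]
    · congr 1; push_cast; ring
    · rw [stripIndex_sub_two]; omega

theorem stripIndex_add_two (l : ℂ) : stripIndex (l + 2) = stripIndex l + 1 := by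
  have := stripIndex_sub_two (l + 2)
  rw [add_sub_cancel_right] at this
  omega

theorem stripIndex_zero : stripIndex 0 = 0 := by simp [stripIndex]

/-- At index `-1` the point `l + 2` lies in the strip, where both `u` and the factor `h` may
contribute; elsewhere `b` only translates. -/
theorem ordAt_bFun_of_ne (c : ℂˣ) (m : Strip →₀ ℤ) {r : RatFunc ℂ} (h0 : r ≠ 0) {l : ℂ}
    (hl : stripIndex l ≠ -1) : ordAt l (bFun (uOf c m) r) = ordAt (l + 2) r := by
  have h1 := stripIndex_add_two l
  have h2 : l + 2 ≠ 0 := fun h => by rw [h, stripIndex_zero] at h1; omega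
  rw [ordAt_bFun c m l h0, exponentAt_eq, if_neg (by omega), if_neg h2]
  omega

theorem ordAt_iterate_bFun (c : ℂˣ) (m : Strip →₀ ℤ) {r : RatFunc ℂ} (h0 : r ≠ 0) {l : ℂ}
    (hl : 0 ≤ stripIndex l) (n : ℕ) :
    ordAt l ((bFun (uOf c m))^[n] r) = ordAt (l + n * 2) r := by
  induction n generalizing l with
  | zero => simp
  | succ n ih =>
    rw [Function.iterate_succ_apply', ordAt_bFun_of_ne c m (iterate_bFun_ne_zero h0 n) (by omega),
      ih]
    · congr 1; push_cast; ring
    · rw [stripIndex_add_two]; omega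

/-- It suffices to find, for each `l`, an element of `V` without a zero at `l`. Iterating `a` when
`l` is left of the strip, and `b` otherwise, moves to `l` a point where a given non-zero element has
order zero, without crossing the strip's boundary. -/
theorem toRat_mem_of_ne_bot {c : ℂˣ} {m : Strip →₀ ℤ} (V : Submodule Weyl (N (uOf c m)))
    (hV : V ≠ ⊥) (P : ℂ[X]) : N.of (uOf c m) (toRat P) ∈ V := by
  obtain ⟨v, hv, hv0⟩ := V.ne_bot_iff.1 hV
  obtain ⟨r, rfl⟩ := (N.of (uOf c m)).surjective v
  have h0 : r ≠ 0 := by rintro rfl; exact hv0 (map_zero _)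
  refine toRat_mem_of_forall V (fun l => ?_) P
  rcases lt_or_ge (stripIndex l) 0 with hl | hl
  · obtain ⟨n, hn⟩ := exists_ordAt_add_eq_zero h0 l (z := -2) (by norm_num)
    refine exists_toRat_mem_of_ordAt_nonpos V (iterate_aFun_ne_zero h0 n)
      (iterate_aFun_mem V hv n) ?_
    rw [ordAt_iterate_aFun c m h0 hl, hn]
  · obtain ⟨n, hn⟩ := exists_ordAt_add_eq_zero h0 l (z := 2) (by norm_num)
    refine exists_toRat_mem_of_ordAt_nonpos V (iterate_bFun_ne_zero h0 n)
      (iterate_bFun_mem V hv n) ?_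
    rw [ordAt_iterate_bFun c m h0 hl, hn]

/-- The first application of `a` to `1` creates the order `m s` at `s`; the next `i` applications
carry it to `s + 2i`. -/
theorem ordAt_iterate_aFun_one (c : ℂˣ) (m : Strip →₀ ℤ) (s : Strip) (i : ℕ) :
    ordAt ((s : ℂ) + 2 * (i : ℤ)) ((aFun (uOf c m))^[i + 1] 1) = m s := by
  induction i with
  | zero =>
    rw [Function.iterate_one, ordAt_aFun c m _ one_ne_zero, ordAt_one]
    simp [exponentAt_coe]
  | succ i ih =>
    rw [Function.iterate_succ_apply', ordAt_aFun c m _ (iterate_aFun_ne_zero one_ne_zero _),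
      exponentAt_eq, stripIndex_coe_add, if_neg (by omega), ← ih, add_zero]
    congr 1
    push_cast; ring

open Classical in
theorem ordAt_iterate_bFun_one (c : ℂˣ) (m : Strip →₀ ℤ) (s : Strip) (i : ℕ) :
    ordAt ((s : ℂ) + 2 * ((-(i + 1) : ℤ) : ℂ)) ((bFun (uOf c m))^[i + 1] 1) =
      -m s + if (s : ℂ) = 0 then 1 else 0 := by
  induction i with
  | zero =>
    have : (s : ℂ) + 2 * ((-((0 : ℕ) + 1) : ℤ) : ℂ) + 2 = s := by push_cast; ring
    rw [Function.iterate_one, ordAt_bFun c m _ one_ne_zero, ordAt_one, this, exponentAt_coe]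
    ring
  | succ i ih =>
    rw [Function.iterate_succ_apply', ordAt_bFun_of_ne c m (iterate_bFun_ne_zero one_ne_zero _),
      ← ih]
    · congr 1
      push_cast; ring
    · rw [stripIndex_coe_add]; omega

/-- `V` contains all polynomials, in particular `1`. The iterates of `a` and `b` on `1` have poles
of the maximal permitted order at the translates of the strip, and a pole of that order yields all
smaller powers. -/
theorem DWeyl_le {c : ℂˣ} {m : Strip →₀ ℤ} (V : Submodule Weyl (N (uOf c m))) (hV : V ≠ ⊥) :
    DWeyl c m ≤ V := by
  have hpoly := toRat_mem_of_ne_bot V hV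
  have h1 : N.of (uOf c m) 1 ∈ V := by simpa using hpoly 1
  intro v hv
  obtain ⟨r, rfl⟩ := (N.of (uOf c m)).surjective v
  rw [of_mem_DWeyl_iff] at hv
  induction hv using Submodule.span_induction with
  | zero => rw [map_zero]; exact V.zero_mem
  | add r s _ _ hr hs => rw [map_add]; exact V.add_mem hr hs
  | smul t r _ hr => rw [map_smul, ← algebraMap_smul Weyl]; exact V.smul_mem _ hr
  | mem r hr =>
    rcases exists_of_mem_dGenerators hr with ⟨P, rfl⟩ | ⟨l, k, hk1, hk2, rfl⟩
    · exact hpoly P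
    rcases le_or_gt 0 (stripIndex l) with hl | hl
    · obtain ⟨i, hi⟩ := Int.eq_ofNat_of_zero_le hl
      refine one_div_pow_mem_of_ordAt V hpoly (iterate_aFun_ne_zero one_ne_zero (i + 1))
        (iterate_aFun_mem V h1 _) l k ?_
      have := ordAt_iterate_aFun_one c m (stripRep l) i
      rw [← hi, stripRep_add] at this
      rw [this]
      rw [poleBound, if_pos hl] at hk2
      omega
    -- Here the strip index is `-(i + 1)`: already the first application of `b` reaches index `-1`.
    · obtain ⟨i, hi⟩ := Int.eq_ofNat_of_zero_le (show 0 ≤ -stripIndex l - 1 by omega)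
      refine one_div_pow_mem_of_ordAt V hpoly (iterate_bFun_ne_zero one_ne_zero (i + 1))
        (iterate_bFun_mem V h1 _) l k ?_
      have := ordAt_iterate_bFun_one c m (stripRep l) i
      rw [← hi, show -(-stripIndex l - 1 + 1) = stripIndex l by ring, stripRep_add] at this
      rw [this]
      rw [poleBound, if_neg (by omega)] at hk2
      split_ifs at hk2 ⊢ <;> omega

theorem DWeyl_ne_bot (c : ℂˣ) (m : Strip →₀ ℤ) : DWeyl c m ≠ ⊥ := fun h => by
  have := toRat_mem_DWeyl c m 1
  rw [h, Submodule.mem_bot, LinearEquiv.map_eq_zero_iff, map_one] at this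
  exact one_ne_zero this

theorem isAtom_DWeyl (c : ℂˣ) (m : Strip →₀ ℤ) : IsAtom (DWeyl c m) :=
  ⟨DWeyl_ne_bot c m, fun V hV => by
    by_contra h
    exact absurd (DWeyl_le V h) (not_le_of_gt hV)⟩

/-- `D_u` is non-zero and lies in every non-zero submodule, so it is the only simple submodule. -/
theorem F_eq_DWeyl (c : ℂˣ) (m : Strip →₀ ℤ) : F (uOf c m) = DWeyl c m := by
  apply le_antisymm
  · refine sSup_le fun S hS => ?_
    have hS' := isSimpleModule_iff_isAtom.1 hS
    exact ((hS'.le_iff.1 (DWeyl_le S hS'.1)).resolve_left (DWeyl_ne_bot c m)).ge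
  · exact le_sSup (isSimpleModule_iff_isAtom.2 (isAtom_DWeyl c m))

theorem isSimpleModule_F (c : ℂˣ) (m : Strip →₀ ℤ) : IsSimpleModule Weyl (F (uOf c m)) := by
  rw [F_eq_DWeyl]
  exact isSimpleModule_iff_isAtom.2 (isAtom_DWeyl c m)

theorem F_restrictScalars (c : ℂˣ) (m : Strip →₀ ℤ) :
    (F (uOf c m)).restrictScalars ℂ = D c m := by
  rw [F_eq_DWeyl]
  rfl

/-! ### Torsion free modules of rank one as modules of rational functions -/

/-- The automorphism `h ↦ 2 h - 1` of the polynomial algebra. -/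
def weightEquiv : ℂ[X] ≃ₐ[ℂ] ℂ[X] :=
  letI : Invertible (2 : ℂ) := invertibleOfNonzero two_ne_zero
  Polynomial.algEquivCMulXAddC 2 (-1)

theorem aeval_h_weightEquiv (P : ℂ[X]) :
    Polynomial.aeval U.h (weightEquiv P) = Polynomial.aeval U.weight P := by
  have : (Polynomial.aeval U.h : ℂ[X] →ₐ[ℂ] U).comp (weightEquiv : ℂ[X] →ₐ[ℂ] ℂ[X]) =
      Polynomial.aeval U.weight := by
    have h2 : algebraMap ℂ U 2 = 2 := map_ofNat _ 2
    ext
    simp [weightEquiv, U.weight, h2, sub_eq_add_neg]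
  exact DFunLike.congr_fun this P

/-- The automorphism `h ↦ 2 h - 1` of the field of rational functions. -/
def weightFieldEquiv : RatFunc ℂ ≃ₐ[ℂ] RatFunc ℂ := IsFractionRing.algEquivOfAlgEquiv weightEquiv

theorem weightFieldEquiv_toRat (P : ℂ[X]) :
    weightFieldEquiv (toRat P) = toRat (weightEquiv P) :=
  IsFractionRing.algEquivOfAlgEquiv_algebraMap _ _

/-- The identification of the underlying groups of `M` and `ResH M`. -/
def ResH.of (M : Type*) [AddCommGroup M] : M ≃+ ResH M := AddEquiv.refl M

theorem ResH.of_smul {M : Type*} [AddCommGroup M] [Module U M] (P : ℂ[X]) (v : M) :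
    ResH.of M (Polynomial.aeval U.h P • v) = P • ResH.of M v := rfl

/-- An embedding of a module into the rational functions, under which the element `2 h - 1` acts as
multiplication by the variable. -/
structure IsWeightEmbedding {M : Type*} [AddCommGroup M] [Module U M] (j : M →+ RatFunc ℂ) :
    Prop where
  injective : Function.Injective j
  aeval_smul : ∀ (P : ℂ[X]) (v : M), j (Polynomial.aeval U.weight P • v) = toRat P * j v

/-- Torsion freeness makes `M → ℂ(h) ⊗ M` injective, and rank one identifies the target with `ℂ(h)`.
The inverse of the substitution `h ↦ 2h - 1` then turns the action of `2h - 1` into multiplication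
by the variable. -/
theorem IsTorsionFreeOfRankOne.exists_embedding {M : Type*} [AddCommGroup M] [Module U M]
    (hM : IsTorsionFreeOfRankOne M) : ∃ j : M →+ RatFunc ℂ, IsWeightEmbedding j := by
  obtain ⟨htf, hrank⟩ := hM
  obtain ⟨e⟩ : Nonempty ((RatFunc ℂ ⊗[ℂ[X]] ResH M) ≃ₗ[RatFunc ℂ] RatFunc ℂ) := by
    rw [Module.nonempty_linearEquiv_iff_lift_rank_eq, hrank, Module.rank_self]
    simp
  let f : ResH M →ₗ[ℂ[X]] RatFunc ℂ ⊗[ℂ[X]] ResH M := TensorProduct.mk ℂ[X] (RatFunc ℂ) (ResH M) 1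
  have hloc : IsLocalizedModule (nonZeroDivisors ℂ[X]) f :=
    (isLocalizedModule_iff_isBaseChange (nonZeroDivisors ℂ[X]) (RatFunc ℂ) f).2
      (TensorProduct.isBaseChange _ _ _)
  have hf : Function.Injective f := by
    rw [injective_iff_map_eq_zero]
    intro v hv
    obtain ⟨c, hc⟩ := (IsLocalizedModule.eq_zero_iff (nonZeroDivisors ℂ[X]) f).1 hv
    exact (smul_eq_zero (r := (c : ℂ[X])).1 hc).resolve_left (nonZeroDivisors.ne_zero c.2)
  let j : M →+ RatFunc ℂ := (weightFieldEquiv.symm : RatFunc ℂ →+ RatFunc ℂ).comp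
    ((e.toLinearMap.toAddMonoidHom.comp f.toAddMonoidHom).comp (ResH.of M : M →+ ResH M))
  have hj : ∀ v, j v = weightFieldEquiv.symm (e (f (ResH.of M v))) := fun v => rfl
  refine ⟨j, (weightFieldEquiv.symm.injective.comp e.injective).comp hf, fun P v => ?_⟩
  rw [hj, hj, ← aeval_h_weightEquiv, ResH.of_smul, map_smul, ← algebraMap_smul (RatFunc ℂ),
    map_smul, smul_eq_mul, map_mul, ← weightFieldEquiv_toRat, AlgEquiv.symm_apply_apply]

/-- Localization preserves rank. The embedding bounds the rank above by `1`, and a non-zero torsion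
free module has positive rank. -/
theorem IsWeightEmbedding.isTorsionFreeOfRankOne {M : Type} [AddCommGroup M] [Module U M]
    [Nontrivial M] {j : M →+ RatFunc ℂ} (hj : IsWeightEmbedding j) : IsTorsionFreeOfRankOne M := by
  let i : ResH M →ₗ[ℂ[X]] RatFunc ℂ :=
    { toFun := fun v => weightFieldEquiv (j ((ResH.of M).symm v))
      map_add' := fun v w => by rw [map_add, map_add, map_add]
      map_smul' := fun P v => by
        obtain ⟨v, rfl⟩ := (ResH.of M).surjective v
        obtain ⟨P, rfl⟩ := weightEquiv.surjective P
        rw [← ResH.of_smul, AddEquiv.symm_apply_apply, AddEquiv.symm_apply_apply,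
          aeval_h_weightEquiv, hj.aeval_smul, map_mul, weightFieldEquiv_toRat, RingHom.id_apply,
          Algebra.smul_def] }
  have hi : Function.Injective i :=
    weightFieldEquiv.injective.comp (hj.injective.comp (ResH.of M).symm.injective)
  have htf : Module.IsTorsionFree ℂ[X] (ResH M) :=
    hi.moduleIsTorsionFree i (fun P v => map_smul i P v)
  refine ⟨htf, ?_⟩
  have : Nontrivial (ResH M) := ‹Nontrivial M›
  let f : ResH M →ₗ[ℂ[X]] RatFunc ℂ ⊗[ℂ[X]] ResH M := TensorProduct.mk ℂ[X] (RatFunc ℂ) (ResH M) 1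
  have hloc : IsLocalizedModule (nonZeroDivisors ℂ[X]) f :=
    (isLocalizedModule_iff_isBaseChange (nonZeroDivisors ℂ[X]) (RatFunc ℂ) f).2
      (TensorProduct.isBaseChange _ _ _)
  rw [IsLocalization.rank_eq (RatFunc ℂ) (nonZeroDivisors ℂ[X]) le_rfl,
    IsLocalizedModule.rank_eq (nonZeroDivisors ℂ[X]) le_rfl f]
  apply le_antisymm
  · refine (LinearMap.rank_le_of_injective i hi).trans ?_
    rw [← IsLocalization.rank_eq (RatFunc ℂ) (nonZeroDivisors ℂ[X]) le_rfl, Module.rank_self]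
  · exact Cardinal.one_le_iff_pos.2 rank_pos

/-- Any `v` is proportional over `ℂ[h]` to a fixed `v₀`, so a semilinear `T` is determined by `T
v₀`. It is applied to `p` with `τ = σ`, and with `τ = id` to `Σ` and to isomorphisms. -/
theorem exists_multiplier {M : Type*} [AddCommGroup M] [Module U M] {j : M →+ RatFunc ℂ}
    (hj : IsWeightEmbedding j) (τ : RatFunc ℂ ≃ₐ[ℂ] RatFunc ℂ) (T : M → RatFunc ℂ)
    (hT : ∀ (P : ℂ[X]) (v : M), T (Polynomial.aeval U.weight P • v) = τ (toRat P) * T v) :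
    ∃ w, ∀ v, T v = τ (j v) * w := by
  by_cases hzero : ∀ v, j v = 0
  · refine ⟨0, fun v => ?_⟩
    have hv : v = 0 := hj.injective (by rw [hzero, map_zero])
    have := hT 0 v
    rw [map_zero, zero_smul, map_zero, map_zero, zero_mul] at this
    rw [hv, this, mul_zero]
  push Not at hzero
  obtain ⟨v₀, hv₀⟩ := hzero
  have hτ : ∀ {r}, r ≠ 0 → τ r ≠ 0 := fun {r} hr => by simpa using hr
  refine ⟨T v₀ / τ (j v₀), fun v => ?_⟩
  obtain ⟨A, B, hB, hAB⟩ := exists_div (j v / j v₀)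
  have hB' := toRat_ne_zero hB
  rw [div_eq_div_iff hv₀ hB'] at hAB
  have h1 : Polynomial.aeval U.weight B • v = Polynomial.aeval U.weight A • v₀ := by
    apply hj.injective
    rw [hj.aeval_smul, hj.aeval_smul, mul_comm, hAB]
  have h2 := congrArg T h1
  rw [hT, hT] at h2
  have h3 := congrArg τ hAB
  rw [map_mul, map_mul] at h3
  rw [← mul_div_assoc, eq_div_iff (hτ hv₀)]
  apply mul_left_cancel₀ (hτ hB')
  linear_combination τ (j v₀) * h2 - T v₀ * h3

/-! ### The SCasimir element acts by zero -/

theorem mul_aeval_of_semiconj {A : Type*} [Ring A] [Algebra ℂ A] {x y z : A} (h : x * y = z * x)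
    (P : ℂ[X]) : x * Polynomial.aeval y P = Polynomial.aeval z P * x := by
  induction P using Polynomial.induction_on with
  | C c => rw [Polynomial.aeval_C, Polynomial.aeval_C, Algebra.commutes]
  | add P Q hP hQ => rw [map_add, map_add, mul_add, add_mul, hP, hQ]
  | monomial n c ih =>
    have : (Polynomial.C c * Polynomial.X ^ (n + 1) : ℂ[X]) =
        Polynomial.C c * Polynomial.X ^ n * Polynomial.X := by ring
    rw [this, map_mul, map_mul (Polynomial.aeval z), Polynomial.aeval_X, Polynomial.aeval_X,
      ← mul_assoc, ih, mul_assoc, h, mul_assoc]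

theorem p_mul_weight : U.p * U.weight = (U.weight - 2) * U.p := by
  have h := U.h_mul_p
  unfold U.weight
  rw [sub_eq_iff_eq_add] at h
  simp only [mul_sub, sub_mul, mul_assoc, h, mul_one, one_mul]
  noncomm_ring

theorem p_mul_aeval_weight (P : ℂ[X]) : U.p * Polynomial.aeval U.weight P =
    Polynomial.aeval U.weight (P.comp (Polynomial.X - Polynomial.C 2)) * U.p := by
  rw [mul_aeval_of_semiconj p_mul_weight, Polynomial.aeval_comp]
  have h2 : algebraMap ℂ U 2 = 2 := map_ofNat _ 2
  simp [h2]

theorem scasimir_mul_weight : U.scasimir * U.weight = U.weight * U.scasimir := by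
  have h1 : U.h * (U.p * U.q) = (U.p * U.q) * U.h := by
    have : U.h * (U.p * U.q) - (U.p * U.q) * U.h =
      (U.h * U.p - U.p * U.h) * U.q + U.p * (U.h * U.q - U.q * U.h) := by noncomm_ring
    rw [← sub_eq_zero, this, U.h_mul_p, U.h_mul_q]
    noncomm_ring
  have h2 : U.h * (U.q * U.p) = (U.q * U.p) * U.h := by
    have : U.h * (U.q * U.p) - (U.q * U.p) * U.h =
      (U.h * U.q - U.q * U.h) * U.p + U.q * (U.h * U.p - U.p * U.h) := by noncomm_ring
    rw [← sub_eq_zero, this, U.h_mul_p, U.h_mul_q]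
    noncomm_ring
  have h3 : Commute U.h U.scasimir :=
    ((Commute.sub_right h1 h2)).add_right (Algebra.commutes _ _).symm
  exact (((Commute.ofNat_left 2 _).mul_left h3).sub_left (Commute.one_left _)).symm

/-- In `Σp + pΣ` the terms `pqp` cancel, leaving `[e, q] + p = 0`; the summand `1/2` of `Σ` provides
the `p`. -/
theorem scasimir_mul_p : U.scasimir * U.p = -(U.p * U.scasimir) := by
  have h := U.e_mul_q
  rw [← U.p_mul_p] at h
  have h1 : algebraMap ℂ U (1 / 2) * U.p + U.p * algebraMap ℂ U (1 / 2) = U.p := by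
    rw [← Algebra.commutes, ← add_mul, ← map_add]
    norm_num
  rw [eq_neg_iff_add_eq_zero]
  calc U.scasimir * U.p + U.p * U.scasimir = (U.p * U.p * U.q - U.q * (U.p * U.p)) +
        (algebraMap ℂ U (1 / 2) * U.p + U.p * algebraMap ℂ U (1 / 2)) := by
        unfold U.scasimir; noncomm_ring
    _ = 0 := by rw [h, h1, neg_add_cancel]

section

variable {M : Type*} [AddCommGroup M] [Module U M] {j : M →+ RatFunc ℂ}

theorem IsWeightEmbedding.weight_smul (hj : IsWeightEmbedding j) (v : M) :
    j (U.weight • v) = RatFunc.X * j v := by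
  have := hj.aeval_smul Polynomial.X v
  rwa [Polynomial.aeval_X, RatFunc.algebraMap_X] at this

theorem IsWeightEmbedding.exists_p_smul (hj : IsWeightEmbedding j) :
    ∃ w, ∀ v, j (U.p • v) = sigma (j v) * w :=
  exists_multiplier hj sigma (fun v => j (U.p • v)) fun P v => by
    rw [smul_smul, p_mul_aeval_weight, mul_smul, hj.aeval_smul, sigma_toRat]

/-- If `p` acted by zero, so would `h = pq + qp`; then `2h - 1` would act as `-1` rather than as the
variable. -/
theorem IsWeightEmbedding.ne_zero_of_p_smul (hj : IsWeightEmbedding j) {w : RatFunc ℂ}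
    (hw : ∀ v, j (U.p • v) = sigma (j v) * w) {v : M} (hv : j v ≠ 0) : w ≠ 0 := by
  rintro rfl
  have hp : ∀ v : M, U.p • v = 0 := fun v => hj.injective (by rw [hw, mul_zero, map_zero])
  have hh : U.h • v = 0 := by
    rw [← U.p_mul_q, add_smul, mul_smul, mul_smul, hp, hp, smul_zero, add_zero]
  have h1 := hj.weight_smul v
  rw [U.weight, sub_smul, mul_smul, hh, smul_zero, one_smul, zero_sub, map_neg] at h1
  have h2 : (RatFunc.X - RatFunc.C (-1)) * j v = 0 := by
    rw [sub_mul, ← h1, map_neg, map_one]; ring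
  exact (mul_ne_zero (X_sub_C_ne_zero (-1)) hv) h2

/-- `Σ` commutes with `h`, so it is multiplication by some `g`; anticommutation with `p` gives `σ(g)
= -g`, impossible for `g ≠ 0` since `-1` is not an eigenvalue of `σ`. -/
theorem IsWeightEmbedding.scasimir_smul (hj : IsWeightEmbedding j) (v : M) :
    U.scasimir • v = 0 := by
  obtain ⟨w, hw⟩ := hj.exists_p_smul
  obtain ⟨g, hg⟩ := exists_multiplier hj AlgEquiv.refl (fun v => j (U.scasimir • v)) fun P v => by
    rw [smul_smul, mul_aeval_of_semiconj scasimir_mul_weight, mul_smul, hj.aeval_smul]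
    rfl
  simp only [AlgEquiv.coe_refl, id] at hg
  apply hj.injective
  rw [map_zero, hg]
  by_contra hne
  have hv : j v ≠ 0 := left_ne_zero_of_mul hne
  have hg0 : g ≠ 0 := right_ne_zero_of_mul hne
  have hw0 := hj.ne_zero_of_p_smul hw hv
  have hsv : sigma (j v) ≠ 0 := by simpa using hv
  have key : j (U.scasimir • U.p • v) = -j (U.p • U.scasimir • v) := by
    rw [smul_smul, scasimir_mul_p, neg_smul, mul_smul, map_neg]
  rw [hg, hw, hw, hg, map_mul] at key
  have hsg : sigma g = RatFunc.C (-1) * g := by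
    apply mul_left_cancel₀ (mul_ne_zero hsv hw0)
    rw [map_neg, map_one]
    linear_combination key
  have := eq_one_of_sigma_eq hg0 hsg
  norm_num at this

/-- A map to `N_u` that is compatible with the actions of `h` and `p` is linear over `U`, if `Σ`
acts by zero. -/
theorem IsWeightEmbedding.of_smul (hj : IsWeightEmbedding j) {u : (RatFunc ℂ)ˣ}
    (hp : ∀ v, j (U.p • v) = invSqrtTwo • (sigma (j v) * u)) (x : U) (v : M) :
    N.of u (j (x • v)) = Theta x • N.of u (j v) := by
  induction x using U.induction generalizing v with
  | scalar c =>
    have := hj.aeval_smul (Polynomial.C c) v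
    rw [Polynomial.aeval_C, RatFunc.algebraMap_C, ← RatFunc.smul_eq_C_mul] at this
    rw [this, AlgHom.commutes, algebraMap_smul, map_smul]
  | p => rw [hp, Theta_p, smul_assoc, a_smul_of, map_smul]
  | q =>
    -- Because `2h - 1 = 4pq - 2Σ` and `Σ` acts by zero, `4pq` acts as the variable. Solving for `q`
    -- through the known, invertible action of `p` gives the formula for `b`.
    have h4 : (4 : ℂ) • j (U.p • U.q • v) = RatFunc.X * j v := by
      have hs := hj.scasimir_smul v
      have hU : U.weight = algebraMap ℂ U 4 * (U.p * U.q) - algebraMap ℂ U 2 * U.scasimir := by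
        have h1 : algebraMap ℂ U 2 * algebraMap ℂ U (1 / 2) = 1 := by rw [← map_mul]; norm_num
        have h2 : algebraMap ℂ U 2 = 2 := map_ofNat _ 2
        have h3 : algebraMap ℂ U 4 = 4 := map_ofNat _ 4
        rw [U.scasimir, mul_add, h1, U.weight, ← U.p_mul_q, h2, h3]
        noncomm_ring
      rw [← hj.weight_smul, hU, sub_smul, mul_smul (algebraMap ℂ U 2), hs, smul_zero, sub_zero,
        mul_smul, mul_smul, ← Polynomial.aeval_C U.weight, hj.aeval_smul, RatFunc.algebraMap_C,
        RatFunc.smul_eq_C_mul]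
    rw [Theta_q, neg_smul, smul_assoc, b_smul_of, ← map_smul, ← map_neg]
    congr 1
    apply sigma.injective
    rw [map_neg, sigma_smul, map_neg, sigma_smul, AlgEquiv.apply_symm_apply, ← h4, hp]
    simp only [smul_mul_assoc, Units.mul_inv_cancel_right, smul_smul]
    rw [smul_neg, neg_neg, smul_smul]
    have : invSqrtTwo * (1 / 2 * (4 * invSqrtTwo)) = 1 := by
      linear_combination two_invSqrtTwo_mul
    rw [this, one_smul]
  | mul x y hx hy => rw [mul_smul, hx, hy, map_mul, mul_smul]
  | add x y hx hy => rw [add_smul, map_add, map_add, hx, hy, map_add, add_smul]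

theorem IsWeightEmbedding.mul_left (hj : IsWeightEmbedding j) {g : RatFunc ℂ} (hg : g ≠ 0) :
    IsWeightEmbedding ((AddMonoidHom.mulLeft g).comp j) where
  injective := fun v w h => hj.injective (mul_left_cancel₀ hg h)
  aeval_smul P v := by
    simp only [AddMonoidHom.comp_apply, AddMonoidHom.coe_mulLeft, hj.aeval_smul]
    ring

theorem exists_equiv_pullback_F [IsSimpleModule U M] (hM : IsTorsionFreeOfRankOne M) :
    ∃ (c : ℂˣ) (m : Strip →₀ ℤ), Nonempty (M ≃ₗ[U] Pullback (F (uOf c m))) := by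
  obtain ⟨i, hi⟩ := hM.exists_embedding
  obtain ⟨w, hw⟩ := hi.exists_p_smul
  have : Nontrivial M := IsSimpleModule.nontrivial U M
  obtain ⟨v₀, hv₀⟩ := exists_ne (0 : M)
  have hw0 := hi.ne_zero_of_p_smul hw
    (fun h => hv₀ (hi.injective (by rw [h, map_zero])))
  have hC0 : RatFunc.C (2 * invSqrtTwo) ≠ 0 := by simp [invSqrtTwo_ne_zero]
  -- As `Θ(p) = a / √2`, the relevant function is `√2 w`. Replacing `i` by `g i` multiplies it by `g
  -- / σ(g)`, so `g` can be chosen to reach the normal form.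
  obtain ⟨c, m, g, hg, hnf⟩ := exists_normalForm (mul_ne_zero hC0 hw0)
  obtain ⟨j, hj, hjg⟩ : ∃ j : M →+ RatFunc ℂ, IsWeightEmbedding j ∧ ∀ v, j v = g * i v :=
    ⟨_, hi.mul_left hg, fun v => rfl⟩
  have hp : ∀ v, j (U.p • v) = invSqrtTwo • (sigma (j v) * uOf c m) := fun v => by
    have h1 : RatFunc.C (2 * invSqrtTwo) * RatFunc.C invSqrtTwo = 1 := by
      rw [← map_mul, two_invSqrtTwo_mul, map_one]
    rw [hjg, hjg, hw, map_mul, RatFunc.smul_eq_C_mul]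
    linear_combination (RatFunc.C invSqrtTwo * sigma (i v)) * hnf - (g * sigma (i v) * w) * h1
  have hlin := hj.of_smul hp
  refine ⟨c, m, ?_⟩
  let V : Submodule Weyl (N (uOf c m)) :=
    { carrier := {r | ∃ v, N.of (uOf c m) (j v) = r}
      add_mem' := by
        rintro _ _ ⟨v, rfl⟩ ⟨v', rfl⟩
        exact ⟨v + v', by rw [map_add, map_add]⟩
      zero_mem' := ⟨0, by rw [map_zero, map_zero]⟩
      smul_mem' := by
        rintro x _ ⟨v, rfl⟩
        obtain ⟨x, rfl⟩ := Theta_surjective x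
        exact ⟨x • v, hlin x v⟩ }
  have hinj : Function.Injective fun v => N.of (uOf c m) (j v) :=
    (N.of (uOf c m)).injective.comp hj.injective
  have hV : V ≠ ⊥ := by
    rw [Submodule.ne_bot_iff]
    exact ⟨_, ⟨v₀, rfl⟩, fun h => hv₀ (hinj (h.trans (by simp)))⟩
  have hFV : F (uOf c m) ≤ V := by rw [F_eq_DWeyl]; exact DWeyl_le V hV
  -- The preimage of `F_u` is non-zero because `F_u` lies in the image `V`. By simplicity it is all
  -- of `M`, so the image equals `F_u`.
  let M' : Submodule U M :=
    { carrier := {v | N.of (uOf c m) (j v) ∈ F (uOf c m)}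
      add_mem' := fun {v v'} hv hv' => by
        change N.of (uOf c m) (j (v + v')) ∈ F (uOf c m)
        rw [map_add, map_add]; exact Submodule.add_mem _ hv hv'
      zero_mem' := by
        change N.of (uOf c m) (j 0) ∈ F (uOf c m)
        rw [map_zero, map_zero]; exact Submodule.zero_mem _
      smul_mem' := fun x v hv => by
        change N.of (uOf c m) (j (x • v)) ∈ F (uOf c m)
        rw [hlin]; exact Submodule.smul_mem _ _ hv }
  have hM' : M' = ⊤ := by
    refine (eq_bot_or_eq_top M').resolve_left fun h => ?_
    have hF : F (uOf c m) ≠ ⊥ := by rw [F_eq_DWeyl]; exact DWeyl_ne_bot c m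
    obtain ⟨r, hr, hr0⟩ := (Submodule.ne_bot_iff _).1 hF
    obtain ⟨v, rfl⟩ := hFV hr
    have hv : v ∈ M' := hr
    rw [h, Submodule.mem_bot] at hv
    exact hr0 (by rw [hv, map_zero, map_zero])
  have hmem : ∀ v, N.of (uOf c m) (j v) ∈ F (uOf c m) := fun v =>
    (hM' ▸ Submodule.mem_top : v ∈ M')
  let φ : M →ₗ[U] Pullback (F (uOf c m)) :=
    { toFun := fun v => (⟨N.of (uOf c m) (j v), hmem v⟩ : F (uOf c m))
      map_add' := fun v v' => Subtype.ext (by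
        change N.of (uOf c m) (j (v + v')) = N.of (uOf c m) (j v) + N.of (uOf c m) (j v')
        rw [map_add, map_add])
      map_smul' := fun x v => Subtype.ext (hlin x v) }
  refine ⟨LinearEquiv.ofBijective φ ⟨fun v v' h => hinj (congrArg Subtype.val h), fun r => ?_⟩⟩
  obtain ⟨r, hr⟩ := r
  obtain ⟨v, hv⟩ := hFV hr
  exact ⟨v, Subtype.ext hv⟩

end

/-! ### The modules `Θ* F_u` -/

/-- The inclusion of `Θ* F_u` into the rational functions. -/
def coordF (u : (RatFunc ℂ)ˣ) : Pullback (F u) →+ RatFunc ℂ where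
  toFun v := (N.of u).symm ((show F u from v) : N u)
  map_zero' := rfl
  map_add' _ _ := rfl

theorem of_coordF_smul (u : (RatFunc ℂ)ˣ) (x : U) (v : Pullback (F u)) :
    N.of u (coordF u (x • v)) = Theta x • N.of u (coordF u v) := rfl

theorem isWeightEmbedding_coordF (u : (RatFunc ℂ)ˣ) : IsWeightEmbedding (coordF u) where
  injective _ _ h := Subtype.ext h
  aeval_smul P v := (N.of u).injective (by rw [of_coordF_smul, Theta_aeval_smul_of])

theorem coordF_p_smul (u : (RatFunc ℂ)ˣ) (v : Pullback (F u)) :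
    coordF u (U.p • v) = invSqrtTwo • (sigma (coordF u v) * u) :=
  (N.of u).injective (by rw [of_coordF_smul, Theta_p, smul_assoc, a_smul_of, map_smul])

/-- Since `Θ` is surjective, the submodules over `U` and over the Weyl algebra are the same. -/
theorem isSimpleModule_pullback {M : Type*} [AddCommGroup M] [Module Weyl M]
    [IsSimpleModule Weyl M] : IsSimpleModule U (Pullback M) := by
  let l : Pullback M →ₛₗ[(Theta : U →+* Weyl)] M :=
    { toFun := fun v => v
      map_add' := fun _ _ => rfl
      map_smul' := fun _ _ => rfl }
  exact (l.isSimpleModule_iff_of_bijective Function.bijective_id).2 ‹_›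

theorem isTorsionFreeOfRankOne_pullback_F (c : ℂˣ) (m : Strip →₀ ℤ) :
    IsTorsionFreeOfRankOne (Pullback (F (uOf c m))) := by
  have := isSimpleModule_F c m
  have : Nontrivial (Pullback (F (uOf c m))) := IsSimpleModule.nontrivial Weyl (F (uOf c m))
  exact (isWeightEmbedding_coordF (uOf c m)).isTorsionFreeOfRankOne

/-- An isomorphism commutes with `h`, so it is multiplication by some `g`. Comparing both sides on
`p` applied to the element `1` gives `u g = u' σ(g)`. -/
theorem eq_of_pullback_F_equiv {c c' : ℂˣ} {m m' : Strip →₀ ℤ}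
    (φ : Pullback (F (uOf c m)) ≃ₗ[U] Pullback (F (uOf c' m'))) : c = c' ∧ m = m' := by
  have hj := isWeightEmbedding_coordF (uOf c m)
  have hj' := isWeightEmbedding_coordF (uOf c' m')
  obtain ⟨g, hg⟩ := exists_multiplier hj AlgEquiv.refl (fun v => coordF (uOf c' m') (φ v))
    fun P v => by rw [map_smul, hj'.aeval_smul]; rfl
  simp only [AlgEquiv.coe_refl, id] at hg
  have h1 : N.of (uOf c m) 1 ∈ F (uOf c m) := by
    rw [F_eq_DWeyl]
    simpa using toRat_mem_DWeyl c m 1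
  obtain ⟨v, hv⟩ : ∃ v : Pullback (F (uOf c m)), coordF (uOf c m) v = 1 :=
    ⟨(⟨N.of (uOf c m) 1, h1⟩ : F (uOf c m)), rfl⟩
  have hφv : coordF (uOf c' m') (φ v) = g := by rw [hg, hv, one_mul]
  have hg0 : g ≠ 0 := by
    rintro rfl
    have : φ v = 0 := hj'.injective (by rw [hφv, map_zero])
    rw [LinearEquiv.map_eq_zero_iff] at this
    rw [this, map_zero] at hv
    exact zero_ne_one hv
  have h2 := hg (U.p • v)
  rw [map_smul, coordF_p_smul, coordF_p_smul, hφv, hv, map_one, one_mul, smul_mul_assoc] at h2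
  apply normalForm_unique hg0
  rw [← (smul_right_injective (RatFunc ℂ) invSqrtTwo_ne_zero h2), mul_comm]

end OspRankOne

end

theorem mainTheorem4 :
    -- `Θ` induces an isomorphism from the quotient by the ideal generated by `Σ` onto `A₁`
    (∃ φ : UBar ≃ₐ[ℂ] Weyl, ∀ x : U, φ (toUBar x) = Theta x) ∧
    -- `Σ` acts by zero, and the action factors through the quotient
    (∀ (M : Type*) [AddCommGroup M] [Module U M], IsSimpleModule U M → IsTorsionFreeOfRankOne M →
      (∀ v : M, U.scasimir • v = 0) ∧
      ∃ _ : Module UBar M, ∀ (x : U) (v : M), toUBar x • v = x • v) ∧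
    -- `F_u` is simple and equals `D_u`
    (∀ (c : ℂˣ) (m : Strip →₀ ℤ),
      IsSimpleModule Weyl (F (uOf c m)) ∧ (F (uOf c m)).restrictScalars ℂ = D c m) ∧
    -- the pullbacks are simple modules, torsion free of rank one
    (∀ (c : ℂˣ) (m : Strip →₀ ℤ),
      IsSimpleModule U (Pullback (F (uOf c m))) ∧
      IsTorsionFreeOfRankOne (Pullback (F (uOf c m)))) ∧
    -- completeness
    (∀ (M : Type*) [AddCommGroup M] [Module U M], IsSimpleModule U M → IsTorsionFreeOfRankOne M →
      ∃ (c : ℂˣ) (m : Strip →₀ ℤ), Nonempty (M ≃ₗ[U] Pullback (F (uOf c m)))) ∧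
    -- irredundancy
    (∀ (c c' : ℂˣ) (m m' : Strip →₀ ℤ),
      Nonempty (Pullback (F (uOf c m)) ≃ₗ[U] Pullback (F (uOf c' m'))) → c = c' ∧ m = m') := by
  refine ⟨exists_UBar_algEquiv, fun M _ _ _ hM => ?_,
    fun c m => ⟨isSimpleModule_F c m, F_restrictScalars c m⟩,
    fun c m => ⟨?_, isTorsionFreeOfRankOne_pullback_F c m⟩,
    fun M _ _ _ hM => exists_equiv_pullback_F hM,
    fun c c' m m' ⟨φ⟩ => eq_of_pullback_F_equiv φ⟩
  · obtain ⟨j, hj⟩ := hM.exists_embedding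
    exact ⟨hj.scasimir_smul, exists_UBar_module hj.scasimir_smul⟩
  · have := isSimpleModule_F c m
    exact isSimpleModule_pullback
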